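/- Let $R$ be a left coherent ring (every finitely generated left ideal is finitely presented), so that the category $R\text{-mod}$ of finitely presented left $R$-modules is abelian. Let $\mathbf{D}_{\rm sg}(R)=\mathbf{D}^b(R\text{-mod})/\mathbf{K}^b(R\text{-proj})$ be its singularity category, that is, the Verdier quotient of the bounded derived category of $R\text{-mod}$ by the perfect complexes (those isomorphic to bounded complexes of finitely generated projective modules). A complex $P$ of finitely generated projective left $R$-modules is totally acyclic if $P$ and $\mathrm{Hom}_R(P,R)$ are acyclic; a finitely presented module $G$ is Gorenstein projective if $G\cong Z^1(P)=\mathrm{Ker}(P^1\to P^2)$ for some totally acyclic $P$. Let $R\text{-}\underline{\mathrm{Gproj}}$ be the stable category of finitely presented Gorenstein projective modules: morphisms are module homomorphisms modulo those that factor through a projective module. It carries the triangulated structure of the stable category of a Frobenius exact category: choosing for each $X$ an exact sequence $0\to X\to I(X)\to \Sigma X\to 0$ with $I(X)$ finitely generated projective and $\Sigma X$ Gorenstein projective, the suspension is $\Sigma$, and the exact triangles are those isomorphic to $X\xrightarrow{u} Y\to C_u\to\Sigma X$, where $C_u$ is the pushout of a homomorphism $u\colon X\to Y$ along $X\to I(X)$.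 Let $$\Phi_R\colon R\text{-}\underline{\mathrm{Gproj}}\longrightarrow \mathbf{D}_{\rm sg}(R)$$ be the functor induced by sending a module to the corresponding stalk complex concentrated in degree zero. Then $\Phi_R$ is a fully faithful triangle functor. Moreover, the following three conditions are equivalent: 1. $\Phi_R$ is dense; 2. $\Phi_R$ is dense up to direct summands, that is, every object of $\mathbf{D}_{\rm sg}(R)$ is a direct summand of $\Phi_R(G)$ for some Gorenstein projective $G$; 3. $R$ is left G-regular, that is, every finitely presented left $R$-module $M$ has finite Gorenstein projective dimension: for some $n\ge 0$ there is an exact sequence $0\to G_n\to\cdots\to G_1\to G_0\to M\to 0$ with each $G_i$ finitely presented Gorenstein projective. -/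

import Mathlib

open CategoryTheory Limits

universe u

namespace SingCat

/-- A ring is left coherent if every finitely generated left ideal is finitely presented
(`Ideal R` consists of the left ideals and `Module R` of the left modules). -/
class IsLeftCoherentRing (R : Type u) [Ring R] : Prop where
  finitePresentation_of_fg : ∀ I : Ideal R, I.FG → Module.FinitePresentation R I

/-- The property of being a finitely presented left `R`-module. -/
def isFinitelyPresented (R : Type u) [Ring R] : ObjectProperty (ModuleCat.{u} R) :=
  fun M => Module.FinitePresentation R M

/-- The category `R-mod` of finitely presented left `R`-modules. It is abelian when `R` is left
coherent, as follows from the closure properties proved below. -/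
abbrev FPMod (R : Type u) [Ring R] := (isFinitelyPresented R).FullSubcategory

section
variable (R : Type u) [Ring R]

lemma finitePresentation_submodule_pi [IsLeftCoherentRing R] (n : ℕ) :
    ∀ N : Submodule R (Fin n → R), N.FG → Module.FinitePresentation R N := by
  induction n with
  | zero => intro N _; infer_instance
  | succ n ih =>
    intro N hN
    -- projection to the first coordinate
    let p : N →ₗ[R] R := (LinearMap.proj (0 : Fin (n+1))) ∘ₗ N.subtype
    have : Module.Finite R N := Module.Finite.iff_fg.2 hN
    have hI : (LinearMap.range p).FG := by
      exact Module.Finite.iff_fg.1 inferInstance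
    have hfp : Module.FinitePresentation R (LinearMap.range p) :=
      IsLeftCoherentRing.finitePresentation_of_fg _ hI
    have hker : (LinearMap.ker p.rangeRestrict).FG :=
      Module.FinitePresentation.fg_ker _ p.surjective_rangeRestrict
    -- the kernel embeds in the remaining coordinates
    let q : LinearMap.ker p.rangeRestrict →ₗ[R] (Fin n → R) :=
      (LinearMap.funLeft R R Fin.succ) ∘ₗ N.subtype ∘ₗ (LinearMap.ker p.rangeRestrict).subtype
    have hq : Function.Injective q := by
      rw [injective_iff_map_eq_zero]
      rintro ⟨⟨x, hx⟩, hx'⟩ h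
      have h0 : x 0 = 0 := by
        have := congrArg Subtype.val (LinearMap.mem_ker.1 hx')
        exact this
      have hs : ∀ i : Fin n, x i.succ = 0 := fun i => congrFun h i
      apply Subtype.ext; apply Subtype.ext; funext i
      refine Fin.cases h0 hs i
    have hfk : Module.Finite R (LinearMap.ker p.rangeRestrict) := Module.Finite.iff_fg.2 hker
    have : Module.FinitePresentation R (LinearMap.range q) :=
      ih _ (Module.Finite.iff_fg.1 inferInstance)
    have : Module.FinitePresentation R (LinearMap.ker p.rangeRestrict) :=
      Module.FinitePresentation.of_equiv (M := LinearMap.range q)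
        (N := LinearMap.ker p.rangeRestrict) (LinearEquiv.ofInjective q hq).symm
    exact Module.finitePresentation_of_ker _ p.surjective_rangeRestrict

lemma finitePresentation_submodule [IsLeftCoherentRing R] {M : Type u} [AddCommGroup M] [Module R M]
    [Module.FinitePresentation R M] (N : Submodule R M) (hN : N.FG) :
    Module.FinitePresentation R N := by
  obtain ⟨n, K, e, hK⟩ := Module.FinitePresentation.exists_fin R M
  let f : (Fin n → R) →ₗ[R] M := e.symm.toLinearMap ∘ₗ K.mkQ
  have hf : Function.Surjective f := e.symm.surjective.comp K.mkQ_surjective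
  have hkf : LinearMap.ker f = K := by
    simp [f, LinearMap.ker_comp]
  let N' : Submodule R (Fin n → R) := N.comap f
  have hN' : N'.FG := by
    apply Submodule.fg_of_fg_map_of_fg_inf_ker f
    · rw [Submodule.map_comap_eq_of_surjective hf]; exact hN
    · rw [inf_eq_right.2 (by rw [← Submodule.comap_bot]; exact Submodule.comap_mono bot_le), hkf]
      exact hK
  have h1 := finitePresentation_submodule_pi R n N' hN'
  let g : N' →ₗ[R] N := f.restrict (fun x hx => hx)
  have hg : Function.Surjective g := by
    rintro ⟨y, hy⟩
    obtain ⟨x, rfl⟩ := hf y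
    exact ⟨⟨x, hy⟩, rfl⟩
  refine Module.finitePresentation_of_surjective g hg ?_
  have hle : K ≤ N' := by rw [← hkf, ← Submodule.comap_bot]; exact Submodule.comap_mono bot_le
  have hkg : LinearMap.ker g = K.comap N'.subtype := by
    rw [← hkf]; ext x
    simp [g, Subtype.ext_iff]
  rw [hkg]
  have : Module.Finite R K := Module.Finite.iff_fg.2 hK
  exact Module.Finite.iff_fg.1 (Module.Finite.equiv (Submodule.comapSubtypeEquivOfLe hle).symm)

instance : (isFinitelyPresented R).IsClosedUnderIsomorphisms where
  of_iso e h := by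
    have : Module.FinitePresentation R _ := h
    exact Module.FinitePresentation.of_equiv e.toLinearEquiv

instance : (isFinitelyPresented R).ContainsZero where
  exists_zero := ⟨ModuleCat.of R PUnit, ModuleCat.isZero_of_subsingleton _,
    (inferInstance : Module.FinitePresentation R PUnit.{u+1})⟩

instance : (isFinitelyPresented R).IsClosedUnderCokernels where
  cokernels_le := by
    rintro C ⟨f, k, hk, hX, hY⟩
    rename_i X Y
    have : Module.FinitePresentation R X := hX
    have : Module.FinitePresentation R Y := hY
    have h := IsColimit.coconePointUniqueUpToIso hk (ModuleCat.cokernelIsColimit f)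
    refine (isFinitelyPresented R).prop_of_iso h.symm ?_
    have hfg : (LinearMap.range f.hom).FG := Module.Finite.iff_fg.1 inferInstance
    exact Module.finitePresentation_of_surjective (LinearMap.range f.hom).mkQ
      (Submodule.mkQ_surjective _) ((Submodule.ker_mkQ (LinearMap.range f.hom)).symm ▸ hfg)

instance [IsLeftCoherentRing R] : (isFinitelyPresented R).IsClosedUnderKernels where
  kernels_le := by
    rintro C ⟨f, k, hk, hX, hY⟩
    rename_i X Y
    have : Module.FinitePresentation R X := hX
    have : Module.FinitePresentation R Y := hY
    have h := IsLimit.conePointUniqueUpToIso hk (ModuleCat.kernelIsLimit f)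
    refine (isFinitelyPresented R).prop_of_iso h.symm ?_
    have : Module.FinitePresentation R (LinearMap.range f.hom) :=
      finitePresentation_submodule R _ (Module.Finite.iff_fg.1 inferInstance)
    have hk : (LinearMap.ker f.hom).FG := by
      have := Module.FinitePresentation.fg_ker f.hom.rangeRestrict f.hom.surjective_rangeRestrict
      rwa [LinearMap.ker_rangeRestrict] at this
    exact finitePresentation_submodule R _ hk

instance : (isFinitelyPresented R).IsClosedUnderFiniteProducts :=
  have : (isFinitelyPresented R).IsClosedUnderBinaryProducts := by
    constructor
    rintro C ⟨p⟩
    have h1 : Module.FinitePresentation R (p.diag.obj ⟨.left⟩) := p.prop_diag_obj _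
    have h2 : Module.FinitePresentation R (p.diag.obj ⟨.right⟩) := p.prop_diag_obj _
    have h := (IsLimit.postcomposeHomEquiv (diagramIsoPair p.diag) _).2 p.isLimit
    refine (isFinitelyPresented R).prop_of_iso (h.conePointUniqueUpToIso (ModuleCat.binaryProductLimitCone _ _).isLimit).symm ?_
    exact Module.FinitePresentation.prod (R := R) (p.diag.obj ⟨.left⟩) (p.diag.obj ⟨.right⟩)
  .mk'

end

section
variable (R : Type u) [Ring R]

/-- A complex `P` of left `R`-modules (cohomological indexing) is a totally acyclic complex of
finitely generated projective modules: each `P.X i` is finitely generated projective, `P` is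
acyclic, and the dual complex `Hom_R(P, R)` is acyclic. -/
structure IsTotallyAcyclic {R : Type u} [Ring R] (P : CochainComplex (ModuleCat.{u} R) ℤ) : Prop where
  finite : ∀ i, Module.Finite R (P.X i)
  projective : ∀ i, Module.Projective R (P.X i)
  exact : ∀ i j k, i + 1 = j → j + 1 = k → Function.Exact (P.d i j).hom (P.d j k).hom
  dual_exact : ∀ i j k, i + 1 = j → j + 1 = k →
    Function.Exact (fun φ : P.X k →ₗ[R] R => φ ∘ₗ (P.d j k).hom)
      (fun φ : P.X j →ₗ[R] R => φ ∘ₗ (P.d i j).hom)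

/-- A finitely presented module `G` is Gorenstein projective if it is isomorphic to the cocycles
`Z¹(P) = Ker (P¹ ⟶ P²)` of a totally acyclic complex `P` of finitely generated projectives. -/
def isGorensteinProjective : ObjectProperty (FPMod R) := fun G =>
  ∃ P : CochainComplex (ModuleCat.{u} R) ℤ, IsTotallyAcyclic P ∧
    Nonempty (G.obj ≃ₗ[R] LinearMap.ker (P.d 1 2).hom)

/-- The category `R-Gproj` of finitely presented Gorenstein projective modules. -/
abbrev Gproj := (isGorensteinProjective R).FullSubcategory

/-- The property that a finitely presented module is projective. -/
def isProj : ObjectProperty (FPMod R) := fun P => Module.Projective R P.obj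

variable {R}

lemma FPMod.surjective_of_epi {X Y : FPMod R} (f : X ⟶ Y) [Epi f] :
    Function.Surjective f.hom.hom := by
  have := (isFinitelyPresented R).preservesEpimorphisms_ι_of_isNormalMonoCategory
  have : Epi f.hom := inferInstanceAs (Epi ((isFinitelyPresented R).ι.map f))
  exact (ModuleCat.epi_iff_surjective f.hom).1 this

lemma isProj_iff (P : FPMod R) : isProj R P ↔ Projective P := by
  constructor
  · intro h
    have : Module.Projective R P.obj := h
    refine ⟨fun {E X} f e _ => ?_⟩
    obtain ⟨g, hg⟩ := Module.projective_lifting_property e.hom.hom f.hom.hom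
      (FPMod.surjective_of_epi e)
    exact ⟨ObjectProperty.homMk (ModuleCat.ofHom g), by ext x; exact LinearMap.congr_fun hg x⟩
  · intro h
    have : Module.FinitePresentation R P.obj := P.property
    obtain ⟨n, m, f, -, hf, -⟩ := Module.FinitePresentation.exists_fin' R P.obj
    let F : FPMod R := ⟨ModuleCat.of R (Fin n → R),
      (inferInstance : Module.FinitePresentation R (Fin n → R))⟩
    let f' : F ⟶ P := ObjectProperty.homMk (ModuleCat.ofHom f)
    have : Epi f' := by
      have : Epi ((isFinitelyPresented R).ι.map f') := (ModuleCat.epi_iff_surjective _).2 hf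
      exact (isFinitelyPresented R).ι.epi_of_epi_map this
    obtain ⟨s, hs⟩ := Projective.factors (𝟙 P) f'
    exact Module.Projective.of_split (M := Fin n → R) s.hom.hom f
      (congrArg (fun g => g.hom.hom) hs)

lemma IsTotallyAcyclic.dual_exact_proj {P : CochainComplex (ModuleCat.{u} R) ℤ}
    (hP : IsTotallyAcyclic P) {Q : Type u} [AddCommGroup Q] [Module R Q] [Module.Finite R Q]
    [Module.Projective R Q] {i j k : ℤ} (hij : i + 1 = j) (hjk : j + 1 = k)
    (f : P.X j →ₗ[R] Q) (hf : f ∘ₗ (P.d i j).hom = 0) :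
    ∃ g : P.X k →ₗ[R] Q, g ∘ₗ (P.d j k).hom = f := by
  obtain ⟨n, r, s, _, _, hrs⟩ := Module.Finite.exists_comp_eq_id_of_projective R Q
  have h (m : Fin n) : ∃ g : P.X k →ₗ[R] R, g ∘ₗ (P.d j k).hom = LinearMap.proj m ∘ₗ s ∘ₗ f :=
    (hP.dual_exact i j k hij hjk _).1 (by
      change LinearMap.proj m ∘ₗ s ∘ₗ f ∘ₗ (P.d i j).hom = 0
      rw [hf]; simp)
  choose g hg using h
  refine ⟨r ∘ₗ LinearMap.pi g, ?_⟩
  have : LinearMap.pi g ∘ₗ (P.d j k).hom = s ∘ₗ f := by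
    ext x m
    exact LinearMap.congr_fun (hg m) x
  rw [LinearMap.comp_assoc, this, ← LinearMap.comp_assoc, hrs, LinearMap.id_comp]

lemma isGorensteinProjective.exists_extension {C : FPMod R} (hC : isGorensteinProjective R C)
    {A B Q : Type u} [AddCommGroup A] [Module R A] [AddCommGroup B] [Module R B]
    [AddCommGroup Q] [Module R Q] [Module.Finite R Q] [Module.Projective R Q]
    (i : A →ₗ[R] B) (p : B →ₗ[R] C.obj) (hi : Function.Injective i) (hp : Function.Surjective p)
    (hip : Function.Exact i p) (a : A →ₗ[R] Q) : ∃ b : B →ₗ[R] Q, b ∘ₗ i = a := by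
  obtain ⟨P, hP, ⟨e⟩⟩ := hC
  have dd (i j k : ℤ) (x : P.X i) : (P.d j k).hom ((P.d i j).hom x) = 0 := by
    have := P.d_comp_d i j k
    exact LinearMap.congr_fun (congrArg ModuleCat.Hom.hom this) x
  let d0 : P.X 0 →ₗ[R] LinearMap.ker (P.d 1 2).hom :=
    (P.d 0 1).hom.codRestrict _ (fun x => dd 0 1 2 x)
  let ε : P.X 0 →ₗ[R] C.obj := e.symm.toLinearMap ∘ₗ d0
  have hε (x : P.X 0) : ε x = 0 ↔ (P.d 0 1).hom x = 0 := by
    rw [LinearMap.comp_apply, LinearEquiv.coe_coe, LinearEquiv.map_eq_zero_iff, Subtype.ext_iff]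
    rfl
  have hεs : Function.Surjective ε := by
    refine e.symm.surjective.comp ?_
    rintro ⟨y, hy⟩
    obtain ⟨x, rfl⟩ := (hP.exact 0 1 2 rfl rfl y).1 hy
    exact ⟨x, rfl⟩
  have := hP.projective 0
  obtain ⟨l, hl⟩ := Module.projective_lifting_property p ε hp
  have hl' (x) : p (l x) = ε x := LinearMap.congr_fun hl x
  let b' : P.X (-1) →ₗ[R] A := (LinearEquiv.ofInjective i hi).symm.toLinearMap ∘ₗ
    (l ∘ₗ (P.d (-1) 0).hom).codRestrict (LinearMap.range i) (fun x => by
      refine (hip _).1 ?_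
      rw [LinearMap.comp_apply, hl', hε]
      exact dd _ _ _ x)
  have hb' (x) : i (b' x) = l ((P.d (-1) 0).hom x) :=
    congrArg Subtype.val ((LinearEquiv.ofInjective i hi).apply_symm_apply
      ((l ∘ₗ (P.d (-1) 0).hom).codRestrict (LinearMap.range i) _ x))
  obtain ⟨c, hc⟩ := hP.dual_exact_proj (i := -2) (j := -1) (k := 0) rfl rfl (a ∘ₗ b') (by
    ext x
    have : b' ((P.d (-2) (-1)).hom x) = 0 := hi (by
      rw [hb', dd, map_zero, map_zero])
    simp [this])
  have hc' (x) : c ((P.d (-1) 0).hom x) = a (b' x) := LinearMap.congr_fun hc x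
  let ψ : (A × P.X 0) →ₗ[R] B := i.coprod l
  let φ : (A × P.X 0) →ₗ[R] Q := a.coprod c
  have hψ : Function.Surjective ψ := by
    intro y
    obtain ⟨x, hx⟩ := hεs (p y)
    obtain ⟨z, hz⟩ := (hip (y - l x)).1 (by rw [map_sub, hl', hx, sub_self])
    exact ⟨(z, x), by simp [ψ, hz]⟩
  have hker : LinearMap.ker ψ ≤ LinearMap.ker φ := by
    rintro ⟨x, y⟩ h
    have h : i x + l y = 0 := h
    have hy : (P.d 0 1).hom y = 0 := by
      rw [← hε, ← hl', eq_neg_of_add_eq_zero_right h, map_neg, hip.apply_apply_eq_zero, neg_zero]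
    obtain ⟨z, rfl⟩ := (hP.exact (-1) 0 1 rfl rfl y).1 hy
    have hx : x = - b' z := hi (by rw [map_neg, hb']; exact eq_neg_of_add_eq_zero_left h)
    change a x + c ((P.d (-1) 0).hom z) = 0
    rw [hc', hx, map_neg, neg_add_cancel]
  refine ⟨(LinearMap.ker ψ).liftQ φ hker ∘ₗ (ψ.quotKerEquivOfSurjective hψ).symm.toLinearMap, ?_⟩
  ext x
  have : (ψ.quotKerEquivOfSurjective hψ).symm (i x) = Submodule.Quotient.mk (x, 0) := by
    rw [LinearEquiv.symm_apply_eq]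
    simp [ψ]
  rw [LinearMap.comp_apply, LinearMap.comp_apply, LinearEquiv.coe_coe, this]
  simp [φ]

/-- A short exact sequence `0 ⟶ X ⟶ I ⟶ S ⟶ 0` of finitely presented modules with `I` projective
and `S` Gorenstein projective, that is, a conflation of the Frobenius exact category `R-Gproj`
starting at `X` whose middle term is projective-injective. -/
structure Cosyzygy (X : Gproj R) where
  I : FPMod R
  S : Gproj R
  ι : X.obj ⟶ I
  π : I ⟶ S.obj
  projective : isProj R I
  injective : Function.Injective ι.hom.hom
  surjective : Function.Surjective π.hom.hom
  exact : Function.Exact ι.hom.hom π.hom.hom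

lemma nonempty_cosyzygy (X : Gproj R) : Nonempty (Cosyzygy X) := by
  obtain ⟨G, P, hP, ⟨e⟩⟩ := X
  have dd (i j k : ℤ) (x : P.X i) : (P.d j k).hom ((P.d i j).hom x) = 0 := by
    have := P.d_comp_d i j k
    exact LinearMap.congr_fun (congrArg ModuleCat.Hom.hom this) x
  have := hP.projective
  have := hP.finite
  have : Module.FinitePresentation R G.obj := G.property
  have hI : Module.FinitePresentation R (P.X 1) := Module.finitePresentation_of_projective _ _
  let π : P.X 1 →ₗ[R] LinearMap.ker (P.d 2 3).hom :=
    (P.d 1 2).hom.codRestrict _ (fun x => dd 1 2 3 x)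
  have hπ : Function.Surjective π := by
    rintro ⟨y, hy⟩
    obtain ⟨x, rfl⟩ := (hP.exact 1 2 3 rfl rfl y).1 hy
    exact ⟨x, rfl⟩
  have hkπ : LinearMap.ker π = LinearMap.ker (P.d 1 2).hom := LinearMap.ker_codRestrict _ _ _
  have hS : Module.FinitePresentation R (LinearMap.ker (P.d 2 3).hom) := by
    refine Module.finitePresentation_of_surjective π hπ ?_
    rw [hkπ]
    exact Module.Finite.iff_fg.1 (Module.Finite.equiv e)
  let P' : CochainComplex (ModuleCat.{u} R) ℤ :=
    { X := fun i => P.X (i + 1)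
      d := fun i j => P.d (i + 1) (j + 1)
      shape := fun i j h => P.shape _ _ (fun h' => h (by
        simp only [ComplexShape.up_Rel] at h' ⊢; lia))
      d_comp_d' := fun _ _ _ _ _ => P.d_comp_d _ _ _ }
  have hP' : IsTotallyAcyclic P' :=
    { finite := fun _ => hP.finite _
      projective := fun _ => hP.projective _
      exact := fun i j k h h' => hP.exact _ _ _ (by lia) (by lia)
      dual_exact := fun i j k h h' => hP.dual_exact _ _ _ (by lia) (by lia) }
  exact ⟨{
    I := ⟨P.X 1, hI⟩
    S := ⟨⟨ModuleCat.of R (LinearMap.ker (P.d 2 3).hom), hS⟩,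
      P', hP', ⟨LinearEquiv.refl R (LinearMap.ker (P.d 2 3).hom)⟩⟩
    ι := ObjectProperty.homMk (ModuleCat.ofHom ((LinearMap.ker (P.d 1 2).hom).subtype ∘ₗ e.toLinearMap))
    π := ObjectProperty.homMk (ModuleCat.ofHom π)
    projective := hP.projective 1
    injective := Subtype.val_injective.comp e.injective
    surjective := hπ
    exact := fun y => by
      constructor
      · intro h
        exact ⟨e.symm ⟨y, by rw [← hkπ]; exact h⟩,
          congrArg Subtype.val (e.apply_symm_apply _)⟩
      · rintro ⟨x, rfl⟩
        have : (e x).1 ∈ LinearMap.ker π := by rw [hkπ]; exact (e x).2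
        exact this }⟩

/-- A choice, for each Gorenstein projective `X`, of a conflation `0 ⟶ X ⟶ I(X) ⟶ S(X) ⟶ 0`. -/
noncomputable def cosyzygy (X : Gproj R) : Cosyzygy X := (nonempty_cosyzygy X).some

namespace Cosyzygy
variable {X : Gproj R} (c : Cosyzygy X)

lemma ι_π : c.ι ≫ c.π = 0 := by
  ext x
  exact c.exact.apply_apply_eq_zero x

lemma exists_ext {J : FPMod R} (hJ : isProj R J) (f : X.obj ⟶ J) :
    ∃ g : c.I ⟶ J, c.ι ≫ g = f := by
  have : Module.Projective R J.obj := hJ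
  have : Module.FinitePresentation R J.obj := J.property
  obtain ⟨b, hb⟩ := c.S.property.exists_extension c.ι.hom.hom c.π.hom.hom c.injective c.surjective
    c.exact f.hom.hom
  exact ⟨ObjectProperty.homMk (ModuleCat.ofHom b), by
    ext x; exact LinearMap.congr_fun hb x⟩

lemma exists_desc {Z : FPMod R} (g : c.I ⟶ Z) (hg : c.ι ≫ g = 0) :
    ∃ h : c.S.obj ⟶ Z, c.π ≫ h = g := by
  have hg' (x) : g.hom.hom (c.ι.hom.hom x) = 0 :=
    LinearMap.congr_fun (congrArg (fun f => f.hom.hom) hg) x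
  have hker : LinearMap.ker c.π.hom.hom ≤ LinearMap.ker g.hom.hom := by
    intro y hy
    obtain ⟨x, rfl⟩ := (c.exact y).1 hy
    exact hg' x
  refine ⟨ObjectProperty.homMk (ModuleCat.ofHom ((LinearMap.ker c.π.hom.hom).liftQ g.hom.hom hker ∘ₗ
    (c.π.hom.hom.quotKerEquivOfSurjective c.surjective).symm.toLinearMap)), ?_⟩
  ext x
  have : (c.π.hom.hom.quotKerEquivOfSurjective c.surjective).symm (c.π.hom.hom x) =
      Submodule.Quotient.mk x := by
    rw [LinearEquiv.symm_apply_eq]; simp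
  change (LinearMap.ker c.π.hom.hom).liftQ g.hom.hom hker
    ((c.π.hom.hom.quotKerEquivOfSurjective c.surjective).symm (c.π.hom.hom x)) = _
  rw [this]; rfl

lemma π_cancel {Z : FPMod R} {f g : c.S.obj ⟶ Z} (h : c.π ≫ f = c.π ≫ g) : f = g := by
  ext x
  obtain ⟨y, rfl⟩ := c.surjective x
  exact LinearMap.congr_fun (congrArg (fun f => f.hom.hom) h) y

end Cosyzygy

variable (R)

/-- A morphism of finitely presented modules factors through a projective module. -/
def FactorsThroughProj {X Y : FPMod R} (f : X ⟶ Y) : Prop :=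
  ∃ (P : FPMod R) (_ : isProj R P) (a : X ⟶ P) (b : P ⟶ Y), a ≫ b = f
variable {R}

namespace FactorsThroughProj
variable {X Y Z : FPMod R}

lemma zero : FactorsThroughProj R (0 : X ⟶ Y) :=
  ⟨⟨ModuleCat.of R PUnit.{u+1}, (inferInstance : Module.FinitePresentation R PUnit.{u+1})⟩,
    (inferInstance : Module.Projective R PUnit.{u+1}), 0, 0, by simp⟩

lemma neg {f : X ⟶ Y} (hf : FactorsThroughProj R f) : FactorsThroughProj R (-f) := by
  obtain ⟨P, hP, a, b, rfl⟩ := hf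
  exact ⟨P, hP, -a, b, by simp⟩

lemma add {f g : X ⟶ Y} (hf : FactorsThroughProj R f) (hg : FactorsThroughProj R g) :
    FactorsThroughProj R (f + g) := by
  obtain ⟨P, hP, a, b, rfl⟩ := hf
  obtain ⟨Q, hQ, a', b', rfl⟩ := hg
  have : Module.FinitePresentation R P.obj := P.property
  have : Module.FinitePresentation R Q.obj := Q.property
  have : Module.Projective R P.obj := hP
  have : Module.Projective R Q.obj := hQ
  refine ⟨⟨ModuleCat.of R (P.obj × Q.obj),
    (inferInstance : Module.FinitePresentation R (P.obj × Q.obj))⟩,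
    (inferInstance : Module.Projective R (P.obj × Q.obj)),
    ObjectProperty.homMk (ModuleCat.ofHom (a.hom.hom.prod a'.hom.hom)),
    ObjectProperty.homMk (ModuleCat.ofHom (b.hom.hom.coprod b'.hom.hom)), ?_⟩
  ext x
  change (b.hom.hom.coprod b'.hom.hom) ((a.hom.hom.prod a'.hom.hom) x) =
    b.hom.hom (a.hom.hom x) + b'.hom.hom (a'.hom.hom x)
  simp

lemma precomp {g : Y ⟶ Z} (hg : FactorsThroughProj R g) (f : X ⟶ Y) :
    FactorsThroughProj R (f ≫ g) := by
  obtain ⟨P, hP, a, b, rfl⟩ := hg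
  exact ⟨P, hP, f ≫ a, b, by simp⟩

lemma postcomp {f : X ⟶ Y} (hf : FactorsThroughProj R f) (g : Y ⟶ Z) :
    FactorsThroughProj R (f ≫ g) := by
  obtain ⟨P, hP, a, b, rfl⟩ := hf
  exact ⟨P, hP, a, b ≫ g, by simp⟩

end FactorsThroughProj

variable (R)

/-- Two morphisms of `R-Gproj` are identified in the stable category if their difference factors
through a projective module. -/
def stableRel : HomRel (Gproj R) := fun _ _ f g => FactorsThroughProj R (f.hom - g.hom)

instance : Congruence (stableRel R) where
  equivalence :=
    { refl := fun f => by simpa [stableRel] using FactorsThroughProj.zero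
      symm := fun h => by simpa [stableRel] using h.neg
      trans := fun h h' => by simpa [stableRel] using h.add h' }
  comp_left f g g' h := by
    simpa [stableRel, ← Preadditive.comp_sub] using FactorsThroughProj.precomp h f.hom
  comp_right g h := by
    simpa [stableRel, ← Preadditive.sub_comp] using FactorsThroughProj.postcomp h g.hom

/-- The stable category of `R-Gproj`: the same objects, and morphisms modulo those which factor
through projective modules. -/
abbrev StableGproj := CategoryTheory.Quotient (stableRel R)

lemma stableRel_add ⦃X Y : Gproj R⦄ (f₁ f₂ g₁ g₂ : X ⟶ Y) (h : stableRel R f₁ f₂)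
    (h' : stableRel R g₁ g₂) : stableRel R (f₁ + g₁) (f₂ + g₂) := by
  have e : (f₁ + g₁).hom - (f₂ + g₂).hom = (f₁.hom - f₂.hom) + (g₁.hom - g₂.hom) := by
    change (f₁.hom + g₁.hom) - (f₂.hom + g₂.hom) = _
    abel
  change FactorsThroughProj R ((f₁ + g₁).hom - (f₂ + g₂).hom)
  rw [e]
  exact FactorsThroughProj.add h h'

instance : Preadditive (StableGproj R) := CategoryTheory.Quotient.preadditive _ (stableRel_add R)

/-- The canonical functor from `R-Gproj` to its stable category. -/
abbrev toStable : Gproj R ⥤ StableGproj R := CategoryTheory.Quotient.functor (stableRel R)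

variable {R}
lemma exists_cosyzygy_map {X Y : Gproj R} (c : Cosyzygy X) (c' : Cosyzygy Y) (f : X ⟶ Y) :
    ∃ (h : c.S ⟶ c'.S) (g : c.I ⟶ c'.I), c.ι ≫ g = f.hom ≫ c'.ι ∧ c.π ≫ h.hom = g ≫ c'.π := by
  obtain ⟨g, hg⟩ := c.exists_ext c'.projective (f.hom ≫ c'.ι)
  obtain ⟨h, hh⟩ := c.exists_desc (g ≫ c'.π) (by rw [reassoc_of% hg, c'.ι_π, comp_zero])
  exact ⟨ObjectProperty.homMk h, g, hg, hh⟩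

lemma cosyzygy_map_unique {X Y : Gproj R} (c : Cosyzygy X) (c' : Cosyzygy Y) {f f' : X ⟶ Y}
    (hff' : stableRel R f f') {h h' : c.S ⟶ c'.S} {g g' : c.I ⟶ c'.I}
    (hg : c.ι ≫ g = f.hom ≫ c'.ι) (hh : c.π ≫ h.hom = g ≫ c'.π)
    (hg' : c.ι ≫ g' = f'.hom ≫ c'.ι) (hh' : c.π ≫ h'.hom = g' ≫ c'.π) : stableRel R h h' := by
  obtain ⟨P, hP, a, b, hab⟩ := hff'
  obtain ⟨a', rfl⟩ := c.exists_ext hP a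
  obtain ⟨k, hk⟩ := c.exists_desc (g - g' - a' ≫ b ≫ c'.ι) (by
    rw [Preadditive.comp_sub, Preadditive.comp_sub, hg, hg', ← Preadditive.sub_comp, ← hab]
    simp)
  refine ⟨c'.I, c'.projective, k, c'.π, c.π_cancel ?_⟩
  rw [reassoc_of% hk, Preadditive.comp_sub, hh, hh', ← Preadditive.sub_comp]
  simp [Preadditive.sub_comp, c'.ι_π]

/-- For `f : X ⟶ Y`, a morphism `S(X) ⟶ S(Y)` induced by an extension `I(X) ⟶ I(Y)` of `f`. -/
noncomputable def cosyzygyMap {X Y : Gproj R} (f : X ⟶ Y) :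
    (cosyzygy X).S ⟶ (cosyzygy Y).S :=
  (exists_cosyzygy_map (cosyzygy X) (cosyzygy Y) f).choose

lemma cosyzygyMap_spec {X Y : Gproj R} (f : X ⟶ Y) :
    ∃ g : (cosyzygy X).I ⟶ (cosyzygy Y).I, (cosyzygy X).ι ≫ g = f.hom ≫ (cosyzygy Y).ι ∧
      (cosyzygy X).π ≫ (cosyzygyMap f).hom = g ≫ (cosyzygy Y).π :=
  (exists_cosyzygy_map (cosyzygy X) (cosyzygy Y) f).choose_spec

variable (R)

/-- The suspension functor of the stable category: it sends `X` to `S(X)`, where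
`0 ⟶ X ⟶ I(X) ⟶ S(X) ⟶ 0` is the chosen conflation, and a morphism to the induced one. -/
noncomputable def stableSuspension : StableGproj R ⥤ StableGproj R :=
  CategoryTheory.Quotient.lift _
    { obj := fun X => (toStable R).obj (cosyzygy X).S
      map := fun f => (toStable R).map (cosyzygyMap f)
      map_id := fun X => by
        obtain ⟨g, hg, hh⟩ := cosyzygyMap_spec (𝟙 X)
        exact (CategoryTheory.Quotient.sound _ (cosyzygy_map_unique _ _
          (Congruence.equivalence.refl (𝟙 X)) hg hh (h' := 𝟙 _) (g' := 𝟙 _)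
          (by simp) (by simp))).trans ((toStable R).map_id _)
      map_comp := fun {X Y Z} f f' => by
        obtain ⟨g, hg, hh⟩ := cosyzygyMap_spec (f ≫ f')
        obtain ⟨g₁, hg₁, hh₁⟩ := cosyzygyMap_spec f
        obtain ⟨g₂, hg₂, hh₂⟩ := cosyzygyMap_spec f'
        rw [← Functor.map_comp]
        exact CategoryTheory.Quotient.sound _ (cosyzygy_map_unique _ _
          (Congruence.equivalence.refl (f ≫ f')) hg hh (g' := g₁ ≫ g₂)
          (by simp [reassoc_of% hg₁, hg₂]) (by simp [reassoc_of% hh₁, hh₂])) }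
    (fun X Y f f' h => by
      obtain ⟨g₁, hg₁, hh₁⟩ := cosyzygyMap_spec f
      obtain ⟨g₂, hg₂, hh₂⟩ := cosyzygyMap_spec f'
      exact CategoryTheory.Quotient.sound _ (cosyzygy_map_unique _ _ h hg₁ hh₁ hg₂ hh₂))
end

section
variable (R : Type u) [Ring R] [IsLeftCoherentRing R]
open DerivedCategory Pretriangulated ZeroObject

/-- The derived category of `R-mod` is the standard localization of the category of complexes. -/
noncomputable instance : HasDerivedCategory.{u + 1} (FPMod R) := HasDerivedCategory.standard _

/-- The perfect complexes: the objects of the derived category of `R-mod` which are isomorphic to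
a bounded complex of finitely generated projective modules. -/
def isPerfect : ObjectProperty (DerivedCategory (FPMod R)) := fun X =>
  ∃ K : CochainComplex (FPMod R) ℤ, (∃ a : ℤ, K.IsStrictlyGE a) ∧ (∃ b : ℤ, K.IsStrictlyLE b) ∧
    (∀ i, isProj R (K.X i)) ∧ Nonempty (X ≅ Q.obj K)

instance : (isPerfect R).IsClosedUnderIsomorphisms where
  of_iso := by
    rintro X Y e ⟨K, ha, hb, hK, ⟨e'⟩⟩
    exact ⟨K, ha, hb, hK, ⟨e.symm ≪≫ e'⟩⟩

variable {R} in
lemma isPerfect_single {P : FPMod R} (hP : isProj R P) :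
    isPerfect R ((singleFunctor (FPMod R) 0).obj P) := by
  refine ⟨(HomologicalComplex.single _ _ 0).obj P, ⟨0, inferInstance⟩, ⟨0, inferInstance⟩,
    fun i => ?_, ⟨Iso.refl _⟩⟩
  by_cases hi : i = 0
  · subst hi
    exact (isProj_iff _).2 (Projective.of_iso
      (HomologicalComplex.singleObjXSelf (ComplexShape.up ℤ) 0 P).symm ((isProj_iff _).1 hP))
  · exact (isProj_iff _).2
      (HomologicalComplex.isZero_single_obj_X (ComplexShape.up ℤ) 0 P i hi).projective

instance : (isPerfect R).ContainsZero where
  exists_zero := ⟨_, (singleFunctor (FPMod R) 0).map_isZero (isZero_zero _),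
    isPerfect_single ((isProj_iff _).2 (isZero_zero (FPMod R)).projective)⟩

instance : (isPerfect R).IsStableUnderShift ℤ where
  isStableUnderShiftBy n :=
    { le_shift := by
        rintro X ⟨K, ⟨a, ha⟩, ⟨b, hb⟩, hK, ⟨e⟩⟩
        exact ⟨K⟦n⟧, ⟨a - n, K.isStrictlyGE_shift a n _ (by lia)⟩,
          ⟨b - n, K.isStrictlyLE_shift b n _ (by lia)⟩, fun i => hK (i + n),
          ⟨(shiftFunctor _ n).mapIso e ≪≫ (Q.commShiftIso n).symm.app K⟩⟩ }

variable {R} in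
lemma isPerfect_mappingCone {K L : CochainComplex (FPMod R) ℤ} (f : K ⟶ L)
    (haK : ∃ a : ℤ, K.IsStrictlyGE a) (hbK : ∃ b : ℤ, K.IsStrictlyLE b)
    (hK : ∀ i, isProj R (K.X i)) (haL : ∃ a : ℤ, L.IsStrictlyGE a)
    (hbL : ∃ b : ℤ, L.IsStrictlyLE b) (hL : ∀ i, isProj R (L.X i)) :
    isPerfect R (Q.obj (CochainComplex.mappingCone f)) := by
  obtain ⟨a, ha⟩ := haK
  obtain ⟨b, hb⟩ := hbK
  obtain ⟨a', ha'⟩ := haL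
  obtain ⟨b', hb'⟩ := hbL
  refine ⟨_, ⟨min (a - 1) a', ?_⟩, ⟨max (b - 1) b', ?_⟩, fun i => ?_, ⟨Iso.refl _⟩⟩
  · rw [CochainComplex.isStrictlyGE_iff]
    intro i hi
    rw [CochainComplex.mappingCone.isZero_X_iff]
    exact ⟨K.isZero_of_isStrictlyGE a _ (by lia), L.isZero_of_isStrictlyGE a' _ (by lia)⟩
  · rw [CochainComplex.isStrictlyLE_iff]
    intro i hi
    rw [CochainComplex.mappingCone.isZero_X_iff]
    exact ⟨K.isZero_of_isStrictlyLE b _ (by lia), L.isZero_of_isStrictlyLE b' _ (by lia)⟩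
  · have h1 := (isProj_iff _).1 (hK (i + 1))
    have h2 := (isProj_iff _).1 (hL i)
    exact (isProj_iff _).2 (Projective.of_iso
      (HomologicalComplex.homotopyCofiber.XIsoBiprod f i (i + 1) rfl).symm inferInstance)

variable {R} in
lemma exists_Q_map_eq {K L : CochainComplex (FPMod R) ℤ} (hbK : ∃ b : ℤ, K.IsStrictlyLE b)
    (hK : ∀ i, isProj R (K.X i)) (f : Q.obj K ⟶ Q.obj L) : ∃ g : K ⟶ L, Q.map g = f := by
  obtain ⟨b, hb⟩ := hbK
  have := fun i => (isProj_iff _).1 (hK i)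
  have := CochainComplex.isKProjective_of_projective K b
  obtain ⟨g, hg⟩ := (CochainComplex.IsKProjective.Qh_map_bijective K
    ((HomotopyCategory.quotient _ _).obj L)).surjective
    ((quotientCompQhIso _).hom.app K ≫ f ≫ (quotientCompQhIso _).inv.app L)
  obtain ⟨g, rfl⟩ := (HomotopyCategory.quotient _ _).map_surjective g
  refine ⟨g, ?_⟩
  rw [← cancel_epi ((quotientCompQhIso _).hom.app K), ← quotientCompQhIso_hom_naturality g, hg]
  simp

instance : (isPerfect R).IsTriangulatedClosed₃ := .mk' (by
  rintro T hT ⟨K, haK, hbK, hK, ⟨e⟩⟩ ⟨L, haL, hbL, hL, ⟨e'⟩⟩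
  obtain ⟨f, hf⟩ := exists_Q_map_eq hbK hK (e.inv ≫ T.mor₁ ≫ e'.hom)
  have h : T.mor₁ ≫ e'.hom = e.hom ≫ Q.map f := by rw [hf, e.hom_inv_id_assoc]
  exact (isPerfect R).prop_of_iso (Triangle.π₃.mapIso (isoTriangleOfIso₁₂ _ _ hT
    (mappingCone_triangle_distinguished f) e e' h)).symm
    (isPerfect_mappingCone f haK hbK hK haL hbL hL))

instance : (isPerfect R).IsTriangulated where
  toIsTriangulatedClosed₂ := .of_isTriangulatedClosed₃

/-- The perfect complexes as objects of the bounded derived category of `R-mod`. -/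
def isPerfectBounded : ObjectProperty (Bounded (FPMod R)) := (isPerfect R).inverseImage Bounded.ι

instance : (isPerfectBounded R).IsTriangulated := by
  dsimp only [isPerfectBounded]; infer_instance
instance : (isPerfectBounded R).IsClosedUnderIsomorphisms := by
  dsimp only [isPerfectBounded]; infer_instance

/-- The singularity category `D_sg(R)`: the Verdier quotient of the bounded derived category of
`R-mod` by the perfect complexes, obtained by inverting the morphisms whose cone is perfect.
Mathlib provides its triangulated structure. -/
abbrev Dsg := (isPerfectBounded R).trW.Localization

/-- The quotient functor from the bounded derived category to `D_sg(R)`. -/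
noncomputable abbrev toDsg : Bounded (FPMod R) ⥤ Dsg R := (isPerfectBounded R).trW.Q

/-- The functor sending a finitely presented module to the stalk complex in degree zero. -/
noncomputable def stalk : FPMod R ⥤ Bounded (FPMod R) :=
  ObjectProperty.lift _ (singleFunctor (FPMod R) 0) (fun X =>
    ⟨⟨0, inferInstanceAs (((singleFunctor (FPMod R) 0).obj X).IsGE 0)⟩, ⟨0, inferInstance⟩⟩)

instance : (stalk R).Additive where
  map_add {X Y f g} := by
    apply (Bounded.ι).map_injective
    exact (singleFunctor (FPMod R) 0).map_add

/-- The composite `R-Gproj ⟶ R-mod ⟶ D^b(R-mod) ⟶ D_sg(R)`. -/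
noncomputable def GprojToDsg : Gproj R ⥤ Dsg R := (isGorensteinProjective R).ι ⋙ stalk R ⋙ toDsg R

lemma isZero_toDsg_stalk (P : FPMod R) (hP : isProj R P) :
    IsZero ((toDsg R).obj ((stalk R).obj P)) := by
  have h : isPerfectBounded R ((stalk R).obj P) := isPerfect_single hP
  have : IsIso ((toDsg R).map (0 : 0 ⟶ (stalk R).obj P)) :=
    Localization.inverts (toDsg R) (isPerfectBounded R).trW _
      (ObjectProperty.trW.mk _ (contractible_distinguished₁ ((stalk R).obj P)) h)
  exact ((toDsg R).map_isZero (isZero_zero _)).of_iso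
    (asIso ((toDsg R).map (0 : 0 ⟶ (stalk R).obj P))).symm

/-- The functor `Φ_R` from the stable category of `R-Gproj` to `D_sg(R)` induced by the composite
`R-Gproj ⟶ R-mod ⟶ D^b(R-mod) ⟶ D_sg(R)`. -/
noncomputable def Phi : StableGproj R ⥤ Dsg R := CategoryTheory.Quotient.lift _ (GprojToDsg R) (by
  rintro X Y f g ⟨P, hP, a, b, h⟩
  have h0 : (toDsg R).map ((stalk R).map (f.hom - g.hom)) = 0 := by
    rw [← h, Functor.map_comp, Functor.map_comp, (isZero_toDsg_stalk R P hP).eq_of_tgt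
      ((toDsg R).map ((stalk R).map a)) 0, zero_comp]
  rw [Functor.map_sub, Functor.map_sub, sub_eq_zero] at h0
  exact h0)

variable {R} in
/-- The standard triangles `X ⟶ Y ⟶ Z ⟶ S(X)`: `Z` is the pushout of `u : X ⟶ Y` along
`X ⟶ I(X)`, and `w : Z ⟶ S(X)` is induced by zero on `Y` and by `I(X) ⟶ S(X)`. -/
def IsStandardTriangle {X Y Z : Gproj R} (u : X ⟶ Y) (v : Y ⟶ Z) (w : Z ⟶ (cosyzygy X).S) : Prop :=
  ∃ j : (cosyzygy X).I ⟶ Z.obj,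
    IsPushout u.hom (cosyzygy X).ι v.hom j ∧ v.hom ≫ w.hom = 0 ∧ j ≫ w.hom = (cosyzygy X).π

variable {R} in
/-- The exact triangles of the stable category: those isomorphic to the image of a standard
triangle. -/
def IsExactTriangle {X Y Z : StableGproj R} (u : X ⟶ Y) (v : Y ⟶ Z)
    (w : Z ⟶ (stableSuspension R).obj X) : Prop :=
  ∃ (X' Y' Z' : Gproj R) (u' : X' ⟶ Y') (v' : Y' ⟶ Z') (w' : Z' ⟶ (cosyzygy X').S)
    (a : X ≅ (toStable R).obj X') (b : Y ≅ (toStable R).obj Y') (c : Z ≅ (toStable R).obj Z'),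
    IsStandardTriangle u' v' w' ∧ u ≫ b.hom = a.hom ≫ (toStable R).map u' ∧
    v ≫ c.hom = b.hom ≫ (toStable R).map v' ∧
    w ≫ (stableSuspension R).map a.hom = c.hom ≫ (toStable R).map w'

/-- `F` is a triangle functor from the stable category to `D_sg(R)`: it is additive and there is
a natural isomorphism `F Σ ≅ Σ F` through which `F` sends exact triangles to exact triangles. -/
def IsTriangleFunctor (F : StableGproj R ⥤ Dsg R) : Prop :=
  F.Additive ∧ ∃ η : stableSuspension R ⋙ F ≅ F ⋙ shiftFunctor (Dsg R) (1 : ℤ),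
    ∀ ⦃X Y Z : StableGproj R⦄ (u : X ⟶ Y) (v : Y ⟶ Z) (w : Z ⟶ (stableSuspension R).obj X),
      IsExactTriangle u v w →
        Triangle.mk (F.map u) (F.map v) (F.map w ≫ η.hom.app X) ∈ distTriang (Dsg R)

/-- `F` is dense up to direct summands: each object of `D_sg(R)` is a direct summand of an object
in the image of `F`. -/
def DenseUpToSummands (F : StableGproj R ⥤ Dsg R) : Prop :=
  ∀ X : Dsg R, ∃ (G : StableGproj R) (Y : Dsg R), Nonempty (F.obj G ≅ X ⊞ Y)

end

section
variable (R : Type u) [Ring R]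

variable {R} in
/-- `Gpd_R(M) ≤ n`: there is an exact sequence `0 ⟶ Gₙ ⟶ ⋯ ⟶ G₁ ⟶ G₀ ⟶ M ⟶ 0` of finitely
presented modules with each `Gᵢ` Gorenstein projective (written as a resolution which is zero
beyond degree `n`). -/
def GpdLE (M : FPMod R) (n : ℕ) : Prop :=
  ∃ (G : ChainComplex (FPMod R) ℕ) (ε : G.X 0 ⟶ M),
    (∀ i, isGorensteinProjective R (G.X i)) ∧ (∀ i, n < i → IsZero (G.X i)) ∧
    Function.Surjective ε.hom.hom ∧ Function.Exact (G.d 1 0).hom.hom ε.hom.hom ∧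
    ∀ i, Function.Exact (G.d (i + 2) (i + 1)).hom.hom (G.d (i + 1) i).hom.hom

/-- `R` is left G-regular: each finitely presented left `R`-module has finite Gorenstein
projective dimension. -/
def IsLeftGRegular : Prop := ∀ M : FPMod R, ∃ n : ℕ, GpdLE M n

end

end SingCat

/-! ### Morphisms out of complexes of projectives, and vanishing of Ext into projectives -/

namespace SingCat

section
universe w v'
open DerivedCategory Pretriangulated ZeroObject
variable {A : Type u} [Category.{v'} A] [Abelian A] [HasDerivedCategory.{w} A]

/-! Everything rests on one property of a Gorenstein projective `G`: `Extⁿ(G, Q) = 0` for `n > 0`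
and `Q` projective (`ExtVanishAbove 0 G`).

Full faithfulness. Because of this vanishing, a morphism from `G` to a perfect complex factors
through a bounded complex `K` of projectives in degrees `≥ 0` (`ExtVanishAbove.exists_factors`).
Such a `K` satisfies `Hom(K, Y[1]) = 0` for each module `Y`, so a fraction from `G` to `Y` can be
corrected to a genuine morphism (`exists_map_eq_of_factors`). A morphism `K ⟶ Y` factors through the
projective `K⁰`, so a map that dies in `D_sg(R)` factors through a projective
(`ExtVanishAbove.factorsThroughProj`). Both statements use only the Ext vanishing of the source and
are applied again to modules not yet known to be Gorenstein projective.

Triangles. Projectives vanish in `D_sg(R)`, so the connecting morphism of `0 ⟶ X ⟶ I(X) ⟶ S(X) ⟶ 0`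
is an isomorphism `S(X) ≅ X[1]`; a standard triangle is a rotation of the triangle of `0 ⟶ Y ⟶ Z ⟶
S(X) ⟶ 0`, up to a sign put into this isomorphism.

Closure properties. The Gorenstein projectives are the largest class with this Ext vanishing in
which each object embeds into a projective with cokernel in the class (`IsCosyzygyClosed`). Closure
under extensions and direct summands follows by enlarging the class and checking that it keeps this
property.

Dense up to summands implies G-regular. If `M` is a summand of `G` in `D_sg(R)`, comparing fractions
gives `Extⁿ(M, Q) = 0` for large `n`, uniformly in `Q`. Enough syzygies remove all positive Ext; the
retraction then lifts to modules up to maps through a projective, so that syzygy of `M` is a summand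
of a Gorenstein projective (`exists_gpdLE_of_retract`).

G-regular implies dense. The objects of `D_sg(R)` coming from Gorenstein projectives are closed
under shifts and, by fullness, under cones. Finite resolutions put every module among them, and
brutal truncation puts every bounded complex among them. -/

lemma exists_Q_map_eq_of_projective (K L : CochainComplex A ℤ) (b : ℤ) [K.IsStrictlyLE b]
    [∀ i, Projective (K.X i)] (f : Q.obj K ⟶ Q.obj L) : ∃ g : K ⟶ L, Q.map g = f := by
  -- A bounded above complex of projectives is K-projective, so morphisms out of it in the derived
  -- category are homotopy classes of chain maps.
  have := CochainComplex.isKProjective_of_projective K b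
  obtain ⟨g, hg⟩ := (CochainComplex.IsKProjective.Qh_map_bijective K
    ((HomotopyCategory.quotient _ _).obj L)).surjective
    ((quotientCompQhIso _).hom.app K ≫ f ≫ (quotientCompQhIso _).inv.app L)
  obtain ⟨g, rfl⟩ := (HomotopyCategory.quotient _ _).map_surjective g
  refine ⟨g, ?_⟩
  rw [← cancel_epi ((quotientCompQhIso _).hom.app K), ← quotientCompQhIso_hom_naturality g, hg]
  simp

lemma exists_Q_map_eq_single (K : CochainComplex A ℤ) (b : ℤ) [K.IsStrictlyLE b]
    [∀ i, Projective (K.X i)] (m : ℤ) (Y : A) (f : Q.obj K ⟶ (singleFunctor A m).obj Y) :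
    ∃ g : K ⟶ (HomologicalComplex.single A (ComplexShape.up ℤ) m).obj Y, Q.map g = f :=
  exists_Q_map_eq_of_projective K _ b f

lemma hom_single_eq_zero (K : CochainComplex A ℤ) (b : ℤ) [K.IsStrictlyLE b]
    [∀ i, Projective (K.X i)] (m : ℤ) (hm : IsZero (K.X m)) (Y : A)
    (f : Q.obj K ⟶ (singleFunctor A m).obj Y) : f = 0 := by
  obtain ⟨g, rfl⟩ := exists_Q_map_eq_single K b m Y f
  have : g = 0 := HomologicalComplex.to_single_hom_ext (hm.eq_of_src _ _)
  rw [this]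
  exact Functor.map_zero _ _ _

/-- The stalk complex in degree `-n` is the `n`-th shift of the stalk complex in degree zero. -/
noncomputable def singleShiftIso (n : ℤ) (Y : A) :
    ((singleFunctor A 0).obj Y)⟦n⟧ ≅ (singleFunctor A (-n)).obj Y :=
  ((singleFunctors A).shiftIso n (-n) 0 (by lia)).app Y

lemma hom_shift_eq_zero (K : CochainComplex A ℤ) (b : ℤ) [K.IsStrictlyLE b]
    [∀ i, Projective (K.X i)] (n : ℤ) (hn : IsZero (K.X (-n))) (Y : A)
    (f : Q.obj K ⟶ ((singleFunctor A 0).obj Y)⟦n⟧) : f = 0 := by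
  rw [← cancel_mono (singleShiftIso n Y).hom, zero_comp]
  exact hom_single_eq_zero K b (-n) hn Y _

lemma single_hom_shift_eq_zero (P : A) [Projective P] (n : ℤ) (hn : 0 < n) (Y : A)
    (f : (singleFunctor A 0).obj P ⟶ ((singleFunctor A 0).obj Y)⟦n⟧) : f = 0 := by
  have (i : ℤ) : Projective (((HomologicalComplex.single A (ComplexShape.up ℤ) 0).obj P).X i) := by
    by_cases hi : i = 0
    · subst hi
      exact Projective.of_iso
        (HomologicalComplex.singleObjXSelf (ComplexShape.up ℤ) 0 P).symm inferInstance
    · exact (HomologicalComplex.isZero_single_obj_X (ComplexShape.up ℤ) 0 P i hi).projective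
  exact hom_shift_eq_zero ((HomologicalComplex.single A (ComplexShape.up ℤ) 0).obj P) 0 n
    (HomologicalComplex.isZero_single_obj_X (ComplexShape.up ℤ) 0 P _ (by lia)) Y f

/-- All morphisms from `X` to `Q[n]` vanish for `Q` projective and `n > m`, that is,
`Extⁿ(X, Q) = 0`. -/
def ExtVanishAbove (m : ℤ) : ObjectProperty A := fun X =>
  ∀ (Q : A) (_ : Projective Q) (n : ℤ), m < n →
    ∀ f : (singleFunctor A 0).obj X ⟶ ((singleFunctor A 0).obj Q)⟦n⟧, f = 0

lemma ExtVanishAbove.of_projective {P : A} [Projective P] : ExtVanishAbove 0 P :=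
  fun Q _ n hn f => single_hom_shift_eq_zero P n hn Q f

lemma ExtVanishAbove.of_le {m m' : ℤ} {X : A} (hX : ExtVanishAbove m X) (h : m ≤ m') :
    ExtVanishAbove m' X :=
  fun Q hQ n hn f => hX Q hQ n (by lia) f

end

section
open Pretriangulated
variable {C : Type*} [Category* C] [Preadditive C] [HasZeroObject C]
  [HasShift C ℤ] [∀ n : ℤ, (shiftFunctor C n).Additive] [Pretriangulated C]
  {X Y Z : C} {f : X ⟶ Y} {g : Y ⟶ Z} {h : Z ⟶ X⟦(1 : ℤ)⟧}
  (hT : Triangle.mk f g h ∈ distTriang C)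
include hT

lemma desc₂_of_distTriang {W : C} (k : Y ⟶ W) (hk : f ≫ k = 0) : ∃ l : Z ⟶ W, k = g ≫ l :=
  Triangle.yoneda_exact₂ _ hT k hk

lemma desc₃_of_distTriang {W : C} (k : Z ⟶ W) (hk : g ≫ k = 0) :
    ∃ l : X⟦(1 : ℤ)⟧ ⟶ W, k = h ≫ l :=
  Triangle.yoneda_exact₃ _ hT k hk

lemma lift₂_of_distTriang {W : C} (k : W ⟶ Y) (hk : k ≫ g = 0) : ∃ l : W ⟶ X, k = l ≫ f :=
  Triangle.coyoneda_exact₂ _ hT k hk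

lemma lift₃_of_distTriang {W : C} (k : W ⟶ Z) (hk : k ≫ h = 0) : ∃ l : W ⟶ Y, k = l ≫ g :=
  Triangle.coyoneda_exact₃ _ hT k hk

lemma desc₁_of_distTriang {W : C} (k : X ⟶ W) (hk : h ≫ k⟦(1 : ℤ)⟧' = 0) :
    ∃ l : Y ⟶ W, k = f ≫ l := by
  have hT' : Triangle.mk g h (-f⟦(1 : ℤ)⟧') ∈ distTriang C := rot_of_distTriang _ hT
  obtain ⟨l, hl⟩ := desc₃_of_distTriang hT' (k⟦(1 : ℤ)⟧') hk
  obtain ⟨l, rfl⟩ := (shiftFunctor C (1 : ℤ)).map_surjective l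
  -- The sign undoes that of `-f⟦1⟧'` in the rotated triangle.
  refine ⟨-l, (shiftFunctor C (1 : ℤ)).map_injective ?_⟩
  rw [hl]
  simp

lemma comp₃₁_of_distTriang : h ≫ f⟦(1 : ℤ)⟧' = 0 := comp_distTriang_mor_zero₃₁ _ hT

end

section
universe w v'
open DerivedCategory Pretriangulated ZeroObject
variable {A : Type u} [Category.{v'} A] [Abelian A] [HasDerivedCategory.{w} A]

lemma singleTriangle_distinguished {S : ShortComplex A} (hS : S.ShortExact) :
    Triangle.mk ((singleFunctor A 0).map S.f) ((singleFunctor A 0).map S.g) hS.singleδ ∈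
      distTriang (DerivedCategory A) := hS.singleTriangle_distinguished

section
variable {S : ShortComplex A} (hS : S.ShortExact)
include hS

/-- Dimension shifting: the obstruction to extending `X₁ ⟶ Q[n]` to `X₂` lies in `Extⁿ⁺¹(X₃, Q)`,
and the extension vanishes because `n > m ≥ 0` and `X₂` is projective. -/
lemma ExtVanishAbove.syzygy [Projective S.X₂] {m : ℤ} (hm : 0 ≤ m)
    (h : ExtVanishAbove (m + 1) S.X₃) : ExtVanishAbove m S.X₁ := by
  intro Q hQ n hn f
  obtain ⟨g, rfl⟩ := desc₁_of_distTriang (singleTriangle_distinguished hS) f (by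
    rw [← cancel_mono ((shiftFunctorAdd' (DerivedCategory A) n 1 (n + 1) rfl).inv.app _), zero_comp]
    exact h Q hQ (n + 1) (by lia) _)
  rw [single_hom_shift_eq_zero S.X₂ n (by lia) Q g, comp_zero]

lemma ExtVanishAbove.extension {m : ℤ} (h₁ : ExtVanishAbove m S.X₁) (h₃ : ExtVanishAbove m S.X₃) :
    ExtVanishAbove m S.X₂ := by
  intro Q hQ n hn f
  obtain ⟨g, rfl⟩ := desc₂_of_distTriang (singleTriangle_distinguished hS) f (h₁ Q hQ n hn _)
  rw [h₃ Q hQ n hn g, comp_zero]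

lemma ExtVanishAbove.exists_extension (h : ExtVanishAbove 0 S.X₃) {Q : A} [Projective Q]
    (f : S.X₁ ⟶ Q) : ∃ g : S.X₂ ⟶ Q, S.f ≫ g = f := by
  obtain ⟨g, hg⟩ := desc₁_of_distTriang (singleTriangle_distinguished hS)
    ((singleFunctor A 0).map f) (h Q inferInstance 1 (by lia) _)
  obtain ⟨g, rfl⟩ := (singleFunctor A 0).map_surjective g
  exact ⟨g, (singleFunctor A 0).map_injective (by rw [hg, Functor.map_comp])⟩

/-- Dimension shifting: `Extⁿ⁺¹(X₃, Q) = 0` if `Extⁿ(X₂, Q) ⟶ Extⁿ(X₁, Q)` is surjective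
and `X₂` is projective. -/
lemma hom_shift_succ_eq_zero [Projective S.X₂] {Q : A} (n : ℤ) (hn : 0 ≤ n)
    (h : ∀ f : (singleFunctor A 0).obj S.X₁ ⟶ ((singleFunctor A 0).obj Q)⟦n⟧,
      ∃ g, f = (singleFunctor A 0).map S.f ≫ g)
    (f : (singleFunctor A 0).obj S.X₃ ⟶ ((singleFunctor A 0).obj Q)⟦n + 1⟧) : f = 0 := by
  obtain ⟨g, rfl⟩ := desc₃_of_distTriang (singleTriangle_distinguished hS) f
    (single_hom_shift_eq_zero S.X₂ (n + 1) (by lia) Q _)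
  let e := (shiftFunctorAdd' (DerivedCategory A) n 1 (n + 1) rfl).app ((singleFunctor A 0).obj Q)
  obtain ⟨g', hg'⟩ : ∃ g', g'⟦(1 : ℤ)⟧' = g ≫ e.hom :=
    (shiftFunctor (DerivedCategory A) (1 : ℤ)).map_surjective _
  obtain ⟨k, rfl⟩ := h g'
  rw [← cancel_mono e.hom, zero_comp, Category.assoc, ← hg', Functor.map_comp,
    reassoc_of% comp₃₁_of_distTriang (singleTriangle_distinguished hS), zero_comp]

end

/-- A class `S` of objects such that, for each `X` in `S`, `Extⁿ(X, Q) = 0` for `n > 0` and `Q`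
projective, and `X` embeds into a projective object with cokernel in `S`. -/
structure IsCosyzygyClosed (S : ObjectProperty A) : Prop where
  ext : ∀ X, S X → ExtVanishAbove 0 X
  cosyzygy : ∀ X, S X → ∃ (P X' : A) (i : X ⟶ P) (p : P ⟶ X') (w : i ≫ p = 0),
    (ShortComplex.mk i p w).ShortExact ∧ Projective P ∧ S X'

end
end SingCat

/-! ### Lifting morphisms from a Verdier quotient, and morphisms to perfect complexes -/

namespace SingCat

section
open Pretriangulated
variable {C D : Type*} [Category* C] [Preadditive C] [HasZeroObject C]
  [HasShift C ℤ] [∀ n : ℤ, (shiftFunctor C n).Additive] [Pretriangulated C]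
  (N : ObjectProperty C) [N.IsTriangulated] [Category* D] [Preadditive D] (L : C ⥤ D) [L.Additive]
  [L.IsLocalization N.trW]

lemma isZero_map_obj_of_prop {P : C} (hP : N P) : IsZero (L.obj P) := by
  obtain ⟨Z, hZ, -⟩ := (inferInstance : N.ContainsZero)
  have : IsIso (L.map (0 : Z ⟶ P)) :=
    Localization.inverts L N.trW _ ⟨P, 𝟙 P, 0, isomorphic_distinguished _
      (contractible_distinguished₁ P) _ (Triangle.isoMk _ _ (hZ.isoZero) (Iso.refl _) (Iso.refl _)
        (hZ.eq_of_src _ _) rfl (((shiftFunctor C (1 : ℤ)).map_isZero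
          (isZero_zero C)).eq_of_tgt _ _)), hP⟩
  exact (L.map_isZero hZ).of_iso (asIso (L.map (0 : Z ⟶ P))).symm

variable [IsTriangulated C] {X Y : C}

include N in
/-- A morphism in the Verdier quotient lifts if morphisms from its source to objects `P` of the
subcategory factor through objects `P'` of the subcategory with `Hom(P', Y[1]) = 0`. -/
lemma exists_map_eq_of_factors
    (H : ∀ P, N P → ∀ g : X ⟶ P, ∃ (P' : C) (a : X ⟶ P') (b : P' ⟶ P), N P' ∧ a ≫ b = g ∧
      ∀ k : P' ⟶ Y⟦(1 : ℤ)⟧, k = 0) (φ : L.obj X ⟶ L.obj Y) : ∃ f : X ⟶ Y, L.map f = φ := by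
  obtain ⟨⟨f, s, hs⟩, rfl⟩ := Localization.exists_leftFraction L N.trW φ
  obtain ⟨P, t, h, hT, hP⟩ := id hs
  obtain ⟨P', a, b, hP', hab, hk⟩ := H P hP (f ≫ t)
  -- Here `φ = s⁻¹f` and `P` is the cone of `s`. Since `Hom(P', Y[1]) = 0`, the map `P' ⟶ P` lifts
  -- to the target of `s`.
  obtain ⟨b, rfl⟩ := lift₃_of_distTriang hT b (hk _)
  -- Subtracting a map through `P'` does not change `f` in the quotient, and the difference dies in
  -- the cone of `s`, so it lifts to `Y`.
  obtain ⟨c, hc⟩ := lift₂_of_distTriang hT (f - a ≫ b) (by simp [hab])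
  refine ⟨c, ?_⟩
  have := Localization.inverts L N.trW s hs
  rw [← cancel_mono (L.map s), MorphismProperty.LeftFraction.map_comp_map_s, ← L.map_comp, ← hc,
    L.map_sub, L.map_comp, (isZero_map_obj_of_prop N L hP').eq_of_tgt (L.map a) 0, zero_comp,
    sub_zero]

include N in
-- Some `s` with cone in `N` satisfies `f ≫ s = 0`, so `f` factors through the fibre of `s`, which
-- is in `N` as well.
lemma exists_factors_of_map_eq_zero (f : X ⟶ Y) (hf : L.map f = 0) :
    ∃ (P : C) (a : X ⟶ P) (b : P ⟶ Y), N P ∧ a ≫ b = f := by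
  obtain ⟨Z, s, hs, h⟩ := (MorphismProperty.map_eq_iff_postcomp L N.trW f 0).1 (by rw [hf, L.map_zero])
  obtain ⟨P, i, t, hT, hP⟩ := (N.trW_iff' s).1 hs
  rw [zero_comp] at h
  obtain ⟨l, rfl⟩ := lift₂_of_distTriang hT f h
  exact ⟨P, l, i, hP, rfl⟩

end

section
universe w v'
open DerivedCategory Pretriangulated ZeroObject
variable {A : Type u} [Category.{v'} A] [Abelian A] [HasDerivedCategory.{w} A]

lemma ExtVanishAbove.hom_single_eq_zero {X : A} (hX : ExtVanishAbove 0 X) {a : ℤ} (ha : a < 0)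
    (P : A) [hP : Projective P] (f : (singleFunctor A 0).obj X ⟶ (singleFunctor A a).obj P) :
    f = 0 := by
  rw [← cancel_mono (((singleFunctors A).shiftIso (-a) a 0 (by lia)).inv.app P), zero_comp]
  exact hX P hP (-a) (by lia) _

/-- The brutal truncation of a complex. -/
lemma exists_brutal_truncation (K : CochainComplex A ℤ) (a b : ℤ) [K.IsStrictlyGE a]
    [K.IsStrictlyLE b] :
    ∃ (K' : CochainComplex A ℤ) (i : Q.obj K' ⟶ Q.obj K)
      (p : Q.obj K ⟶ (singleFunctor A a).obj (K.X a))
      (δ : (singleFunctor A a).obj (K.X a) ⟶ (Q.obj K')⟦(1 : ℤ)⟧),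
      K'.IsStrictlyGE (a + 1) ∧ K'.IsStrictlyLE b ∧
      (∀ i, Projective (K.X i) → Projective (K'.X i)) ∧
      Triangle.mk i p δ ∈ distTriang (DerivedCategory A) := by
  -- The projection to the lowest term is a chain map because `K` vanishes in degree `a - 1`; its
  -- kernel is the part in degrees `> a`.
  let π : K ⟶ (HomologicalComplex.single A (ComplexShape.up ℤ) a).obj (K.X a) :=
    HomologicalComplex.mkHomToSingle (𝟙 _) (fun i hi => by
      simp only [ComplexShape.up_Rel] at hi
      exact (K.isZero_of_isStrictlyGE a i (by lia)).eq_of_src _ _)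
  have hπ : IsIso (π.f a) := by
    rw [HomologicalComplex.mkHomToSingle_f]; infer_instance
  have hs (i : ℤ) (hi : i ≠ a) :=
    HomologicalComplex.isZero_single_obj_X (ComplexShape.up ℤ) a (K.X a) i hi
  have hps (i : ℤ) (hK : Projective (K.X i)) : Projective
      (((HomologicalComplex.single A (ComplexShape.up ℤ) a).obj (K.X a)).X i) := by
    by_cases hi : i = a
    · subst hi
      exact Projective.of_iso (asIso (π.f i)) inferInstance
    · exact (hs i hi).projective
  have (i : ℤ) : Epi (π.f i) := by
    by_cases hi : i = a
    · subst hi; infer_instance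
    · exact ⟨fun _ _ _ => (hs i hi).eq_of_src _ _⟩
  have : Epi π := HomologicalComplex.epi_of_epi_f π inferInstance
  let S := ShortComplex.mk (kernel.ι π) π (kernel.condition π)
  have hS : S.ShortExact :=
    { exact := ShortComplex.exact_of_f_is_kernel _ (kernelIsKernel π) }
  have hSi (i : ℤ) := hS.map_of_exact (HomologicalComplex.eval A (ComplexShape.up ℤ) i)
  have hz (i : ℤ) (hi : IsZero (K.X i)) : IsZero ((kernel π).X i) := by
    have : Mono ((kernel.ι π).f i) := (hSi i).mono_f
    exact hi.of_mono ((kernel.ι π).f i)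
  refine ⟨kernel π, Q.map (kernel.ι π), Q.map π, triangleOfSESδ hS, ?_, ?_, ?_,
    triangleOfSES_distinguished hS⟩
  · rw [CochainComplex.isStrictlyGE_iff]
    intro i hi
    by_cases hia : i = a
    · subst hia
      have : Mono ((kernel.ι π).f i) := (hSi i).mono_f
      have h0 : (kernel.ι π).f i = 0 := by
        rw [← cancel_mono (π.f i), zero_comp, ← HomologicalComplex.comp_f, kernel.condition]
        rfl
      exact IsZero.of_mono_eq_zero _ h0
    · exact hz i (K.isZero_of_isStrictlyGE a i (by lia))
  · rw [CochainComplex.isStrictlyLE_iff]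
    intro i hi
    exact hz i (K.isZero_of_isStrictlyLE b i hi)
  · intro i hK
    have : Projective (S.map (HomologicalComplex.eval A (ComplexShape.up ℤ) i)).X₃ := hps i hK
    -- The quotient is projective in degree `i`, so the sequence splits there and the kernel is a
    -- direct summand of `K.X i`.
    let σ := (hSi i).splittingOfProjective
    exact Retract.projective (Y := K.X i) ⟨(kernel.ι π).f i, σ.r, σ.f_r⟩

/-- A morphism from an object `X` with `Extⁿ(X, proj) = 0` for `n > 0` to a bounded complex of
projectives factors through such a complex concentrated in nonnegative degrees. -/
lemma ExtVanishAbove.exists_factors {X : A} (hX : ExtVanishAbove 0 X) (d : ℕ) :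
    ∀ (K : CochainComplex A ℤ) (a b : ℤ) (_ : -d ≤ a) [K.IsStrictlyGE a]
    [K.IsStrictlyLE b] [∀ i, Projective (K.X i)] (g : (singleFunctor A 0).obj X ⟶ Q.obj K),
    ∃ (K' : CochainComplex A ℤ) (f : (singleFunctor A 0).obj X ⟶ Q.obj K') (i : Q.obj K' ⟶ Q.obj K),
      K'.IsStrictlyGE 0 ∧ K'.IsStrictlyLE b ∧ (∀ i, Projective (K'.X i)) ∧ f ≫ i = g := by
  induction d with
  | zero =>
    intro K a b ha _ _ hK g
    exact ⟨K, g, 𝟙 _, K.isStrictlyGE_of_ge 0 a (by simpa using ha), inferInstance, hK, by simp⟩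
  | succ d ih =>
    intro K a b ha _ _ hK g
    by_cases h0 : 0 ≤ a
    · exact ⟨K, g, 𝟙 _, K.isStrictlyGE_of_ge 0 a h0, inferInstance, hK, by simp⟩
    · obtain ⟨K', i, p, δ, h₁, h₂, h₃, hT⟩ := exists_brutal_truncation K a b
      -- For `a < 0` the composite to the lowest term is a class in `Ext⁻ᵃ(X, K.X a) = 0`, so the
      -- lowest degree can be removed.
      obtain ⟨g, rfl⟩ := lift₂_of_distTriang hT g (hX.hom_single_eq_zero (by lia) (K.X a) _)
      have := fun i => h₃ i (hK i)
      obtain ⟨K'', f, j, h₁', h₂', h₃', rfl⟩ := ih K' (a + 1) b (by push_cast at ha; lia) g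
      exact ⟨K'', f, j ≫ i, h₁', h₂', h₃', by simp⟩

/-- A morphism from a complex of projectives in nonnegative degrees to a stalk complex factors
through a projective object. -/
lemma exists_factors_single (K : CochainComplex A ℤ) (b : ℤ) [K.IsStrictlyGE 0]
    [K.IsStrictlyLE b] [∀ i, Projective (K.X i)] {Y : A}
    (f : Q.obj K ⟶ (singleFunctor A 0).obj Y) :
    ∃ (g : Q.obj K ⟶ (singleFunctor A 0).obj (K.X 0)) (h : K.X 0 ⟶ Y),
      g ≫ (singleFunctor A 0).map h = f := by
  obtain ⟨f, rfl⟩ := exists_Q_map_eq_single K b 0 Y f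
  let π : K ⟶ (HomologicalComplex.single A (ComplexShape.up ℤ) 0).obj (K.X 0) :=
    HomologicalComplex.mkHomToSingle (𝟙 _) (fun i hi => by
      simp only [ComplexShape.up_Rel] at hi
      exact (K.isZero_of_isStrictlyGE 0 i (by lia)).eq_of_src _ _)
  obtain ⟨h, hh⟩ : ∃ h : K.X 0 ⟶ Y,
    h = f.f 0 ≫ (HomologicalComplex.singleObjXSelf (ComplexShape.up ℤ) 0 Y).hom := ⟨_, rfl⟩
  refine ⟨Q.map π, h, ?_⟩
  have : π ≫ (HomologicalComplex.single A (ComplexShape.up ℤ) 0).map h = f := by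
    apply HomologicalComplex.to_single_hom_ext
    rw [HomologicalComplex.comp_f, HomologicalComplex.mkHomToSingle_f,
      HomologicalComplex.single_map_f_self]
    simp [hh]
  rw [← this, Functor.map_comp]
  rfl

end

section
variable (R : Type u) [Ring R] [IsLeftCoherentRing R]
open DerivedCategory Pretriangulated ZeroObject

/-- The functor sending a finitely presented module to its stalk complex in `D_sg(R)`. -/
noncomputable abbrev moduleToDsg : FPMod R ⥤ Dsg R := stalk R ⋙ toDsg R

variable {R}

lemma isPerfectBounded_iff (P : Bounded (FPMod R)) : isPerfectBounded R P ↔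
    ∃ (K : CochainComplex (FPMod R) ℤ) (a b : ℤ), K.IsStrictlyGE a ∧ K.IsStrictlyLE b ∧
      (∀ i, Projective (K.X i)) ∧ Nonempty (Bounded.ι.obj P ≅ Q.obj K) := by
  constructor
  · rintro ⟨K, ⟨a, ha⟩, ⟨b, hb⟩, hK, e⟩
    exact ⟨K, a, b, ha, hb, fun i => (isProj_iff _).1 (hK i), e⟩
  · rintro ⟨K, a, b, ha, hb, hK, e⟩
    exact ⟨K, ⟨a, ha⟩, ⟨b, hb⟩, fun i => (isProj_iff _).2 (hK i), e⟩

/-- A bounded complex as an object of the bounded derived category. -/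
noncomputable def toBounded (K : CochainComplex (FPMod R) ℤ) (a b : ℤ) [K.IsStrictlyGE a]
    [K.IsStrictlyLE b] : Bounded (FPMod R) :=
  ⟨Q.obj K, ⟨a, inferInstanceAs ((Q.obj K).IsGE a)⟩, ⟨b, inferInstanceAs ((Q.obj K).IsLE b)⟩⟩

lemma exists_factors_perfect {X : FPMod R} (hX : ExtVanishAbove 0 X) {P : Bounded (FPMod R)}
    (hP : isPerfectBounded R P) (g : (stalk R).obj X ⟶ P) :
    ∃ (K : CochainComplex (FPMod R) ℤ) (b : ℤ) (_ : K.IsStrictlyGE 0) (_ : K.IsStrictlyLE b)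
      (_ : ∀ i, Projective (K.X i)) (f : (stalk R).obj X ⟶ toBounded K 0 b)
      (h : toBounded K 0 b ⟶ P), f ≫ h = g := by
  obtain ⟨K, a, b, ha, hb, hK, ⟨e⟩⟩ := (isPerfectBounded_iff P).1 hP
  obtain ⟨g', hg'⟩ : ∃ g' : (singleFunctor (FPMod R) 0).obj X ⟶ Bounded.ι.obj P,
    g' = Bounded.ι.map g := ⟨_, rfl⟩
  obtain ⟨K', f, i, h₁, h₂, h₃, hfi⟩ := hX.exists_factors (-a).toNat K a b (by lia) (g' ≫ e.hom)
  refine ⟨K', b, h₁, h₂, h₃, ObjectProperty.homMk f, ObjectProperty.homMk (i ≫ e.inv), ?_⟩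
  apply Bounded.ι.map_injective
  change f ≫ i ≫ e.inv = Bounded.ι.map g
  rw [reassoc_of% hfi, e.hom_inv_id, Category.comp_id, hg']

lemma isPerfectBounded_toBounded (K : CochainComplex (FPMod R) ℤ) (a b : ℤ) [ha : K.IsStrictlyGE a]
    [hb : K.IsStrictlyLE b] [hK : ∀ i, Projective (K.X i)] : isPerfectBounded R (toBounded K a b) :=
  (isPerfectBounded_iff _).2 ⟨K, a, b, ha, hb, hK, ⟨Iso.refl _⟩⟩

lemma bounded_hom_shift_eq_zero {P : Bounded (FPMod R)} {Y : FPMod R} (n : ℤ)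
    (h : ∀ f : Bounded.ι.obj P ⟶ ((singleFunctor (FPMod R) 0).obj Y)⟦n⟧, f = 0)
    (f : P ⟶ ((stalk R).obj Y)⟦n⟧) : f = 0 := by
  apply Bounded.ι.map_injective
  rw [← cancel_mono ((Bounded.ι.commShiftIso n).hom.app _), Functor.map_zero, zero_comp]
  exact h _

/-- Morphisms in `D_sg(R)` from an `X` with `Extⁿ(X, proj) = 0` for `n > 0` come from module
homomorphisms. -/
lemma ExtVanishAbove.exists_map_eq {X Y : FPMod R} (hX : ExtVanishAbove 0 X)
    (φ : (moduleToDsg R).obj X ⟶ (moduleToDsg R).obj Y) :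
    ∃ f : X ⟶ Y, (moduleToDsg R).map f = φ := by
  obtain ⟨f, rfl⟩ := exists_map_eq_of_factors (isPerfectBounded R) (toDsg R) (fun P hP g => by
    obtain ⟨K, b, h₁, h₂, h₃, f, h, hfh⟩ := exists_factors_perfect hX hP g
    -- `Y[1]` sits in degree `-1`, where `K` is zero.
    exact ⟨_, f, h, isPerfectBounded_toBounded K 0 b, hfh, bounded_hom_shift_eq_zero 1
      (hom_shift_eq_zero K b 1 (K.isZero_of_isStrictlyGE 0 _ (by lia)) Y)⟩) φ
  obtain ⟨f', hf'⟩ := (singleFunctor (FPMod R) 0).map_surjective (Bounded.ι.map f)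
  refine ⟨f', ?_⟩
  have : (stalk R).map f' = f := Bounded.ι.map_injective hf'
  change (toDsg R).map ((stalk R).map f') = _
  rw [this]

/-- A map that dies in `D_sg(R)` passes through a perfect complex, hence through a complex `K` of
projectives in degrees `≥ 0`, hence through `K.X 0`; full faithfulness of the stalk functor brings
this factorization back to modules. -/
lemma ExtVanishAbove.factorsThroughProj {X Y : FPMod R} (hX : ExtVanishAbove 0 X) (f : X ⟶ Y)
    (hf : (moduleToDsg R).map f = 0) : FactorsThroughProj R f := by
  obtain ⟨P, a, b, hP, hab⟩ := exists_factors_of_map_eq_zero (isPerfectBounded R) (toDsg R)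
    ((stalk R).map f) hf
  obtain ⟨K, c, h₁, h₂, h₃, a', h, rfl⟩ := exists_factors_perfect hX hP a
  obtain ⟨g, k, hgk⟩ := exists_factors_single K c (Y := Y) (Bounded.ι.map (h ≫ b))
  obtain ⟨a'', ha''⟩ : ∃ a'' : (singleFunctor (FPMod R) 0).obj X ⟶ Q.obj K,
    a'' = Bounded.ι.map a' := ⟨_, rfl⟩
  obtain ⟨l, hl⟩ := (singleFunctor (FPMod R) 0).map_surjective (a'' ≫ g)
  refine ⟨K.X 0, (isProj_iff _).2 (h₃ 0), l, k, (singleFunctor (FPMod R) 0).map_injective ?_⟩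
  rw [Functor.map_comp, hl, Category.assoc, hgk, ha'']
  exact (Bounded.ι.map_comp _ _).symm.trans
    (congrArg Bounded.ι.map ((Category.assoc _ _ _).symm.trans hab))

end
end SingCat

/-! ### Classes closed under cosyzygies: extensions, summands and syzygies -/

namespace SingCat

section
universe w v'
variable {A : Type u} [Category.{v'} A] [Abelian A]

/-- The cokernels of a monomorphism between short exact sequences form a short exact sequence. -/
lemma exists_shortExact_cokernel {S₁ S₂ : ShortComplex A} (h₁ : S₁.ShortExact)
    (h₂ : S₂.ShortExact) (φ : S₁ ⟶ S₂) [Mono φ.τ₁] [Mono φ.τ₂] [Mono φ.τ₃] :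
    ∃ (S₃ : ShortComplex A) (ψ : S₂ ⟶ S₃) (w₁ : φ.τ₁ ≫ ψ.τ₁ = 0) (w₂ : φ.τ₂ ≫ ψ.τ₂ = 0)
      (w₃ : φ.τ₃ ≫ ψ.τ₃ = 0), S₃.ShortExact ∧ (ShortComplex.mk _ _ w₁).ShortExact ∧
        (ShortComplex.mk _ _ w₂).ShortExact ∧ (ShortComplex.mk _ _ w₃).ShortExact := by
  have := h₁.epi_g
  have := h₂.epi_g
  let T : ShortComplex.SnakeInput A :=
    { L₀ := kernel φ
      L₁ := S₁
      L₂ := S₂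
      L₃ := cokernel φ
      v₀₁ := kernel.ι φ
      v₁₂ := φ
      v₂₃ := cokernel.π φ
      w₀₂ := kernel.condition φ
      w₁₃ := cokernel.condition φ
      h₀ := kernelIsKernel φ
      h₃ := cokernelIsCokernel φ
      L₁_exact := h₁.exact
      epi_L₁_g := h₁.epi_g
      L₂_exact := h₂.exact
      mono_L₂_f := h₂.mono_f }
  have : Epi T.L₂.g := h₂.epi_g
  have h0 : T.v₀₁.τ₃ = 0 := by
    rw [← cancel_mono φ.τ₃, zero_comp]
    exact T.w₀₂_τ₃
  have : Mono T.v₀₁.τ₃ := T.mono_v₀₁_τ₃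
  have hz : IsZero T.L₀.X₃ := IsZero.of_mono_eq_zero _ h0
  -- In the snake sequence the connecting morphism starts at the kernel of `φ.τ₃`, which is zero.
  have : Mono T.L₃.f := T.L₂'_exact.mono_g (hz.eq_of_src _ _)
  have : Epi T.L₃.g := T.epi_L₃_g
  exact ⟨T.L₃, T.v₂₃, T.w₁₃_τ₁, T.w₁₃_τ₂, T.w₁₃_τ₃, ⟨T.L₃_exact⟩,
    { exact := T.exact_C₁_down, mono_f := ‹_›, epi_g := T.epi_v₂₃_τ₁ },
    { exact := T.exact_C₂_down, mono_f := ‹_›, epi_g := T.epi_v₂₃_τ₂ },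
    { exact := T.exact_C₃_down, mono_f := ‹_›, epi_g := T.epi_v₂₃_τ₃ }⟩

lemma nonempty_iso_of_shortExact {X P Y Y' : A} {i : X ⟶ P} {p : P ⟶ Y} {p' : P ⟶ Y'}
    {w : i ≫ p = 0} {w' : i ≫ p' = 0} (h : (ShortComplex.mk i p w).ShortExact)
    (h' : (ShortComplex.mk i p' w').ShortExact) : Nonempty (Y ≅ Y') :=
  ⟨IsColimit.coconePointUniqueUpToIso h.gIsCokernel h'.gIsCokernel⟩

/-- The objects which are extensions of objects in `S`. -/
def IsExtensionOf (S : ObjectProperty A) : ObjectProperty A := fun B =>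
  ∃ T : ShortComplex A, T.ShortExact ∧ S T.X₁ ∧ S T.X₃ ∧ T.X₂ = B

/-- The direct summands of objects in `S`. -/
def IsSummandOf (S : ObjectProperty A) : ObjectProperty A := fun X => ∃ Y, S (X ⊞ Y)

/-- If `X ⊞ Y` embeds into `P` with cokernel `Z`, then `P / X ⊞ X` is an extension of `Z` by
`X ⊞ Y`. -/
lemma shortExact_cokernel_biprod {X Y P Z : A} {i : X ⊞ Y ⟶ P} {p : P ⟶ Z} {w : i ≫ p = 0}
    (h : (ShortComplex.mk i p w).ShortExact) :
    ∃ (f : X ⊞ Y ⟶ cokernel (biprod.inl ≫ i) ⊞ X) (g : cokernel (biprod.inl ≫ i) ⊞ X ⟶ Z)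
      (w' : f ≫ g = 0), (ShortComplex.mk f g w').ShortExact := by
  have : Mono i := h.mono_f
  have : Epi p := h.epi_g
  let π := cokernel.π (biprod.inl ≫ i)
  have hπ : biprod.inl ≫ i ≫ π = 0 := by
    rw [← Category.assoc]; exact cokernel.condition _
  let q : cokernel (biprod.inl ≫ i) ⟶ Z := cokernel.desc _ p (by simp [w])
  have hq : π ≫ q = p := cokernel.π_desc _ _ _
  have : Epi q := epi_of_epi_fac hq
  let f : X ⊞ Y ⟶ cokernel (biprod.inl ≫ i) ⊞ X := biprod.lift (i ≫ π) biprod.fst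
  let g : cokernel (biprod.inl ≫ i) ⊞ X ⟶ Z := biprod.fst ≫ q
  have w' : f ≫ g = 0 := by simp [f, g, hq, w]
  have hinl : (ShortComplex.mk (biprod.inl ≫ i) π (cokernel.condition _)).Exact :=
    ShortComplex.exact_cokernel _
  refine ⟨f, g, w', { exact := ?_, mono_f := ?_, epi_g := epi_comp _ _ }⟩
  · rw [ShortComplex.exact_iff_exact_up_to_refinements]
    intro T y hy
    obtain ⟨T', ρ, _, c, hc⟩ := surjective_up_to_refinements_of_epi π (y ≫ biprod.fst)
    obtain ⟨s, hs⟩ : ∃ s, s ≫ i = c := ⟨h.exact.lift c (by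
      change c ≫ p = 0
      have hy' : y ≫ biprod.fst ≫ q = 0 := hy
      rw [← hq, ← Category.assoc, ← hc, Category.assoc, Category.assoc, hy', comp_zero]),
      h.exact.lift_f _ _⟩
    -- The `X`-coordinate of `s` does not affect its image in `P / X`, so it can be replaced by the
    -- second coordinate of `y`.
    refine ⟨T', ρ, inferInstance, s + (ρ ≫ y ≫ biprod.snd - s ≫ biprod.fst) ≫ biprod.inl, ?_⟩
    apply biprod.hom_ext
    · simp [f, hπ, reassoc_of% hs, hc]
    · simp [f]
  · refine Preadditive.mono_of_cancel_zero _ fun {T} t ht => ?_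
    have h1 : t ≫ i ≫ π = 0 := by simpa [f] using ht =≫ biprod.fst
    have h2 : t ≫ biprod.fst = 0 := by simpa [f] using ht =≫ biprod.snd
    obtain ⟨s, hs⟩ : ∃ s, s ≫ biprod.inl ≫ i = t ≫ i :=
      ⟨hinl.lift (t ≫ i) (by rw [Category.assoc]; exact h1), hinl.lift_f _ _⟩
    have hs' : s ≫ biprod.inl = t := by
      rw [← cancel_mono i, Category.assoc, hs]
    rw [← hs'] at h2 ⊢
    have h3 : s = 0 := by simpa using h2
    simp [h3]

variable [HasDerivedCategory.{w} A]

/-- Horseshoe lemma. -/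
lemma IsCosyzygyClosed.isExtensionOf {S : ObjectProperty A} [S.IsClosedUnderIsomorphisms]
    (hS : IsCosyzygyClosed S) : IsCosyzygyClosed (IsExtensionOf S) where
  ext := by
    rintro _ ⟨T, hT, h₁, h₃, rfl⟩
    exact (hS.ext _ h₁).extension hT (hS.ext _ h₃)
  cosyzygy := by
    rintro _ ⟨T, hT, h₁, h₃, rfl⟩
    obtain ⟨P₁, Y₁, i₁, p₁, w₁, hE₁, hP₁, hY₁⟩ := hS.cosyzygy _ h₁
    obtain ⟨P₃, Y₃, i₃, p₃, w₃, hE₃, hP₃, hY₃⟩ := hS.cosyzygy _ h₃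
    -- `Ext¹(X₃, P₁) = 0` extends the embedding of `X₁` to the middle term, which then embeds into
    -- `P₁ ⊞ P₃`.
    obtain ⟨b, hb⟩ := (hS.ext _ h₃).exists_extension hT i₁
    let T' : ShortComplex A := ShortComplex.mk (biprod.inl : P₁ ⟶ P₁ ⊞ P₃) biprod.snd (by simp)
    have hT' : T'.ShortExact :=
      (ShortComplex.Splitting.ofHasBinaryBiproduct P₁ P₃).shortExact
    let φ : T ⟶ T' :=
      { τ₁ := i₁
        τ₂ := biprod.lift b (T.g ≫ i₃)
        τ₃ := i₃
        comm₁₂ := by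
          apply biprod.hom_ext
          · simp [T', hb]
          · simp [T']
        comm₂₃ := by simp [T'] }
    have : Mono φ.τ₁ := hE₁.mono_f
    have : Mono φ.τ₃ := hE₃.mono_f
    have : Mono T.f := hT.mono_f
    have : Mono T'.f := hT'.mono_f
    have : Mono φ.τ₂ := ShortComplex.mono_τ₂_of_exact_of_mono φ hT.exact
    obtain ⟨T'', ψ, v₁, v₂, v₃, hT'', hv₁, hv₂, hv₃⟩ := exists_shortExact_cokernel hT hT' φ
    refine ⟨P₁ ⊞ P₃, T''.X₂, φ.τ₂, ψ.τ₂, v₂, hv₂, inferInstance, T'', hT'', ?_, ?_, rfl⟩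
    · obtain ⟨e⟩ := nonempty_iso_of_shortExact hE₁ hv₁
      exact S.prop_of_iso e hY₁
    · obtain ⟨e⟩ := nonempty_iso_of_shortExact hE₃ hv₃
      exact S.prop_of_iso e hY₃

/-- If `X ⊞ Y` embeds into `P` with cokernel `Z` in `S`, the cokernel of `X ⟶ P` is again a summand
of an object of `S`, with complement `X`: the sum is an extension of `Z` by `X ⊞ Y`. -/
lemma IsCosyzygyClosed.isSummandOf {S : ObjectProperty A} [S.IsClosedUnderIsomorphisms]
    (hS : IsCosyzygyClosed S) (hSe : IsExtensionOf S ≤ S) : IsCosyzygyClosed (IsSummandOf S) where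
  ext := by
    rintro X ⟨Y, h⟩ Q hQ n hn f
    have h0 := hS.ext _ h Q hQ n hn ((DerivedCategory.singleFunctor A 0).map biprod.fst ≫ f)
    have : (DerivedCategory.singleFunctor A 0).map (biprod.inl : X ⟶ X ⊞ Y) ≫
      (DerivedCategory.singleFunctor A 0).map biprod.fst ≫ f = f := by
      rw [← Category.assoc, ← Functor.map_comp]
      simp
    rw [← this, h0, comp_zero]
  cosyzygy := by
    rintro X ⟨Y, h⟩
    obtain ⟨P, Z, i, p, w, hE, hP, hZ⟩ := hS.cosyzygy _ h
    have := hE.mono_f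
    have : Mono i := hE.mono_f
    obtain ⟨f, g, w', hE'⟩ := shortExact_cokernel_biprod hE
    exact ⟨P, cokernel (biprod.inl ≫ i), biprod.inl ≫ i, cokernel.π _, cokernel.condition _,
      { exact := ShortComplex.exact_cokernel _, mono_f := mono_comp _ _, epi_g := inferInstance },
      hP, X, hSe _ ⟨_, hE', h, hZ, rfl⟩⟩

/-- The closure of a class under syzygies. -/
inductive SyzygyClosure (S : ObjectProperty A) : A → Prop
  | of (X : A) (hX : S X) : SyzygyClosure S X
  | syzygy {K P X : A} (i : K ⟶ P) (p : P ⟶ X) (w : i ≫ p = 0)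
      (h : (ShortComplex.mk i p w).ShortExact) (hP : Projective P) (hX : SyzygyClosure S X) :
      SyzygyClosure S K

/-- A syzygy inherits the Ext vanishing and embeds into a projective by construction. With enough
projectives, the closure lets resolutions be continued in both directions. -/
lemma IsCosyzygyClosed.syzygyClosure {S : ObjectProperty A} (hS : IsCosyzygyClosed S) :
    IsCosyzygyClosed (SyzygyClosure S) where
  ext X hX := by
    induction hX with
    | of X hX => exact hS.ext X hX
    | syzygy i p w h hP hX ih =>
      have : Projective (ShortComplex.mk i p w).X₂ := hP
      exact ExtVanishAbove.syzygy h le_rfl (ih.of_le (by lia))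
  cosyzygy X hX := by
    cases hX with
    | of X hX =>
      obtain ⟨P, X', i, p, w, h, hP, hX'⟩ := hS.cosyzygy X hX
      exact ⟨P, X', i, p, w, h, hP, .of _ hX'⟩
    | syzygy i p w h hP hX => exact ⟨_, _, i, p, w, h, hP, hX⟩

end

lemma exists_int_chain {α : Type*} (r : α → α → Prop) (h₁ : ∀ a, ∃ b, r a b)
    (h₂ : ∀ b, ∃ a, r a b) (a : α) (m : ℤ) :
    ∃ x : ℤ → α, x m = a ∧ ∀ n, r (x n) (x (n + 1)) := by
  choose f hf using h₁
  choose g hg using h₂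
  suffices ∃ x : ℤ → α, x 0 = a ∧ ∀ n, r (x n) (x (n + 1)) by
    obtain ⟨x, hx₀, hx⟩ := this
    refine ⟨fun n => x (n - m), by simpa using hx₀, fun n => ?_⟩
    have := hx (n - m)
    rwa [show n - m + 1 = n + 1 - m by lia] at this
  -- `Int.negSucc n` is `-(n + 1)`, which is reached by `n + 1` backward steps.
  refine ⟨fun n => match n with
    | Int.ofNat n => f^[n] a
    | Int.negSucc n => g^[n + 1] a, rfl, ?_⟩
  rintro (n | n)
  · change r (f^[n] a) (f^[n + 1] a)
    rw [Function.iterate_succ_apply']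
    exact hf _
  · cases n with
    | zero => exact hg a
    | succ n =>
      change r (g^[n + 2] a) (g^[n + 1] a)
      rw [Function.iterate_succ_apply' g (n + 1)]
      exact hg _

/-! ### Gorenstein projective modules as the largest cosyzygy-closed class -/

section
open ZeroObject
variable {R : Type u} [Ring R]

/-- The shifts of a totally acyclic complex, without signs in the differentials, are totally
acyclic. -/
lemma IsTotallyAcyclic.shift {P : CochainComplex (ModuleCat.{u} R) ℤ}
    (hP : IsTotallyAcyclic P) (n : ℤ) : IsTotallyAcyclic
      ({ X := fun i => P.X (i + n)
         d := fun i j => P.d (i + n) (j + n)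
         shape := fun i j h => P.shape _ _ (fun h' => h (by
          simp only [ComplexShape.up_Rel] at h' ⊢; lia))
         d_comp_d' := fun _ _ _ _ _ => P.d_comp_d _ _ _ } : CochainComplex (ModuleCat.{u} R) ℤ) :=
  { finite := fun _ => hP.finite _
    projective := fun _ => hP.projective _
    exact := fun i j k h h' => hP.exact _ _ _ (by lia) (by lia)
    dual_exact := fun i j k h h' => hP.dual_exact _ _ _ (by lia) (by lia) }

lemma FPMod.epi_iff {X Y : FPMod R} (f : X ⟶ Y) : Epi f ↔ Function.Surjective f.hom.hom := by
  constructor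
  · intro; exact FPMod.surjective_of_epi f
  · intro h
    have : Epi ((isFinitelyPresented R).ι.map f) := (ModuleCat.epi_iff_surjective _).2 h
    exact (isFinitelyPresented R).ι.epi_of_epi_map this

variable [IsLeftCoherentRing R]

instance : (isFinitelyPresented R).ι.PreservesHomology where
  preservesKernels _ _ f := (isFinitelyPresented R).preservesKernels_ι f
  preservesCokernels _ _ f := (isFinitelyPresented R).preservesCokernels_ι f

lemma FPMod.exact_iff (S : ShortComplex (FPMod R)) :
    S.Exact ↔ Function.Exact S.f.hom.hom S.g.hom.hom := by
  rw [← S.exact_map_iff_of_faithful (isFinitelyPresented R).ι,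
    ShortComplex.ShortExact.moduleCat_exact_iff_function_exact]
  rfl

lemma FPMod.mono_iff {X Y : FPMod R} (f : X ⟶ Y) : Mono f ↔ Function.Injective f.hom.hom := by
  constructor
  · intro
    have : Mono ((isFinitelyPresented R).ι.map f) := inferInstance
    exact (ModuleCat.mono_iff_injective f.hom).1 this
  · intro h
    have : Mono ((isFinitelyPresented R).ι.map f) := (ModuleCat.mono_iff_injective _).2 h
    exact (isFinitelyPresented R).ι.mono_of_mono_map this

lemma FPMod.exists_syzygy (M : FPMod R) : ∃ (K P : FPMod R) (i : K ⟶ P) (p : P ⟶ M)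
    (w : i ≫ p = 0), (ShortComplex.mk i p w).ShortExact ∧ Projective P := by
  have : Module.FinitePresentation R M.obj := M.property
  obtain ⟨n, m, f, -, hf, -⟩ := Module.FinitePresentation.exists_fin' R M.obj
  let F : FPMod R := ⟨ModuleCat.of R (Fin n → R),
    (inferInstance : Module.FinitePresentation R (Fin n → R))⟩
  let p : F ⟶ M := ObjectProperty.homMk (ModuleCat.ofHom f)
  have : Epi p := (FPMod.epi_iff p).2 hf
  exact ⟨kernel p, F, kernel.ι p, p, kernel.condition p,
    { exact := ShortComplex.exact_of_f_is_kernel _ (kernelIsKernel p) },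
    (isProj_iff F).1 (inferInstance : Module.Projective R (Fin n → R))⟩

lemma Cosyzygy.shortExact {X : Gproj R} (c : Cosyzygy X) :
    (ShortComplex.mk c.ι c.π c.ι_π).ShortExact where
  exact := (FPMod.exact_iff _).2 c.exact
  mono_f := (FPMod.mono_iff _).2 c.injective
  epi_g := (FPMod.epi_iff _).2 c.surjective

instance : (isGorensteinProjective R).IsClosedUnderIsomorphisms where
  of_iso := by
    rintro X Y e ⟨P, hP, ⟨e'⟩⟩
    exact ⟨P, hP, ⟨((isFinitelyPresented R).ι.mapIso e).toLinearEquiv.symm ≪≫ₗ e'⟩⟩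

/-- A class of finitely presented modules which is closed under cosyzygies consists of Gorenstein
projective modules. -/
lemma IsCosyzygyClosed.isGorensteinProjective {S : ObjectProperty (FPMod R)}
    (hS : IsCosyzygyClosed S) : S ≤ isGorensteinProjective R := by
  intro X hX
  have hT := hS.syzygyClosure
  let r (X Y : {X : FPMod R // SyzygyClosure S X}) : Prop :=
    ∃ (P : FPMod R) (i : X.1 ⟶ P) (p : P ⟶ Y.1) (w : i ≫ p = 0),
      (ShortComplex.mk i p w).ShortExact ∧ Projective P
  obtain ⟨x, hx0, hx⟩ := exists_int_chain r
    (fun X => by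
      obtain ⟨P, X', i, p, w, h, hP, hX'⟩ := hT.cosyzygy _ X.2
      exact ⟨⟨X', hX'⟩, P, i, p, w, h, hP⟩)
    (fun X => by
      -- The chain is normalized so that `X` has index `1`, to match `Z¹` in the definition of
      -- Gorenstein projective.
      obtain ⟨K, P, i, p, w, h, hP⟩ := FPMod.exists_syzygy X.1
      exact ⟨⟨K, .syzygy i p w h hP X.2⟩, P, i, p, w, h, hP⟩) ⟨X, .of X hX⟩ 1
  choose P i p w h hP using hx
  have hinj (n : ℤ) : Function.Injective (i n).hom.hom := (FPMod.mono_iff _).1 (h n).mono_f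
  have hsurj (n : ℤ) : Function.Surjective (p n).hom.hom := (FPMod.epi_iff _).1 (h n).epi_g
  have hex (n : ℤ) : Function.Exact (i n).hom.hom (p n).hom.hom := (FPMod.exact_iff _).1 (h n).exact
  -- The short exact sequences `x n ⟶ P n ⟶ x (n + 1)` are spliced, so the kernel of `d n` is the
  -- image of `x n`.
  let d (n : ℤ) : (P n).obj ⟶ (P (n + 1)).obj := (p n ≫ i (n + 1)).hom
  have hd (n : ℤ) (y) : (d n).hom y = (i (n + 1)).hom.hom ((p n).hom.hom y) := rfl
  have hd0 (n : ℤ) (y) : (d n).hom y = 0 ↔ (p n).hom.hom y = 0 := by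
    rw [hd, map_eq_zero_iff _ (hinj (n + 1))]
  let K : CochainComplex (ModuleCat.{u} R) ℤ := CochainComplex.of (fun n => (P n).obj) d
    (fun n => by
      ext y
      change (d (n + 1)).hom ((d n).hom y) = 0
      rw [hd0, hd, (hex (n + 1)).apply_apply_eq_zero])
  have hKd (n : ℤ) : K.d n (n + 1) = d n := by
    change CochainComplex.of.d (fun n => (P n).obj) d n (n + 1) = d n
    exact CochainComplex.of_d (X := fun n => (P n).obj) d n
  refine ⟨K, ⟨fun n => ?_, fun n => (isProj_iff _).2 (hP n), ?_, ?_⟩, ?_⟩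
  · have : Module.FinitePresentation R (P n).obj := (P n).property
    exact inferInstanceAs (Module.Finite R (P n).obj)
  · rintro n _ _ rfl rfl
    rw [hKd, hKd]
    intro y
    rw [hd0]
    constructor
    · intro hy
      obtain ⟨z, rfl⟩ := (hex (n + 1) y).1 hy
      obtain ⟨z, rfl⟩ := hsurj n z
      exact ⟨z, rfl⟩
    · rintro ⟨z, rfl⟩
      exact (hex (n + 1)).apply_apply_eq_zero _
  · rintro n _ _ rfl rfl
    rw [hKd, hKd]
    intro φ
    constructor
    · intro hφ
      have hφ' (y) : φ ((i (n + 1)).hom.hom y) = 0 := by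
        obtain ⟨z, rfl⟩ := hsurj n y
        exact LinearMap.congr_fun hφ z
      let RR : FPMod R := ⟨ModuleCat.of R R, (inferInstance : Module.FinitePresentation R R)⟩
      have : Projective RR := (isProj_iff RR).1 (inferInstance : Module.Projective R R)
      let φ' : P (n + 1) ⟶ RR := ObjectProperty.homMk (ModuleCat.ofHom φ)
      obtain ⟨ψ, hψ⟩ : ∃ ψ, p (n + 1) ≫ ψ = φ' :=
        ⟨(h (n + 1)).gIsCokernel.desc (CokernelCofork.ofπ φ' (by ext y; exact hφ' y)),
          (h (n + 1)).gIsCokernel.fac _ WalkingParallelPair.one⟩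
      -- A cocycle of the dual complex descends to `x (n + 2)`, and extends to `P (n + 2)` because
      -- `Ext¹(x (n + 3), R) = 0`.
      obtain ⟨χ, hχ⟩ := ExtVanishAbove.exists_extension (h (n + 1 + 1))
        (hT.ext _ (x (n + 1 + 1 + 1)).2) ψ
      refine ⟨χ.hom.hom, ?_⟩
      have : d (n + 1) ≫ χ.hom = φ'.hom := by
        rw [← hψ, ← hχ]
        rfl
      exact congrArg ModuleCat.Hom.hom this
    · rintro ⟨χ, rfl⟩
      ext y
      change χ ((d (n + 1)).hom ((d n).hom y)) = 0
      rw [show (d (n + 1)).hom ((d n).hom y) = 0 from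
        (hd0 _ _).2 ((hex (n + 1)).apply_apply_eq_zero _), map_zero]
  · have e : K.d 1 2 = d 1 := hKd 1
    rw [e]
    have hker : LinearMap.ker (d 1).hom = LinearMap.range (i 1).hom.hom := by
      ext y
      rw [LinearMap.mem_ker, hd0]
      exact hex 1 y
    rw [hker, ← show (x 1).1 = X from congrArg Subtype.val hx0]
    exact ⟨LinearEquiv.ofInjective _ (hinj 1)⟩

/-- A Gorenstein projective module has a Gorenstein projective syzygy. -/
lemma isGorensteinProjective.exists_syzygy {G : FPMod R} (hG : isGorensteinProjective R G) :
    ∃ (K P : FPMod R) (i : K ⟶ P) (p : P ⟶ G) (w : i ≫ p = 0),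
      (ShortComplex.mk i p w).ShortExact ∧ Projective P ∧ isGorensteinProjective R K := by
  obtain ⟨P, hP, ⟨e⟩⟩ := hG
  have dd (i j k : ℤ) (x : P.X i) : (P.d j k).hom ((P.d i j).hom x) = 0 := by
    have := P.d_comp_d i j k
    exact LinearMap.congr_fun (congrArg ModuleCat.Hom.hom this) x
  have := hP.projective
  have := hP.finite
  let F : FPMod R := ⟨P.X 0, Module.finitePresentation_of_projective _ _⟩
  let d0 : P.X 0 →ₗ[R] LinearMap.ker (P.d 1 2).hom :=
    (P.d 0 1).hom.codRestrict _ (fun x => dd 0 1 2 x)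
  have hd0 : Function.Surjective d0 := by
    rintro ⟨y, hy⟩
    obtain ⟨x, rfl⟩ := (hP.exact 0 1 2 rfl rfl y).1 hy
    exact ⟨x, rfl⟩
  let p : F ⟶ G := ObjectProperty.homMk (ModuleCat.ofHom (e.symm.toLinearMap ∘ₗ d0))
  have : Epi p := (FPMod.epi_iff p).2 (e.symm.surjective.comp hd0)
  let S := ShortComplex.mk (kernel.ι p) p (kernel.condition p)
  have hS : S.ShortExact := { exact := ShortComplex.exact_of_f_is_kernel _ (kernelIsKernel p) }
  refine ⟨kernel p, F, kernel.ι p, p, kernel.condition p, hS, (isProj_iff F).1 (hP.projective 0),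
    -- The syzygy is `Z⁰(P)`, which is `Z¹` of the complex reindexed by `-1`.
    _, hP.shift (-1), ?_⟩
  have hr : LinearMap.range (kernel.ι p).hom.hom = LinearMap.ker (P.d 0 1).hom := by
    ext y
    refine ((FPMod.exact_iff S).1 hS.exact y).symm.trans ?_
    change e.symm (d0 y) = 0 ↔ _
    rw [LinearEquiv.map_eq_zero_iff, Subtype.ext_iff]
    rfl
  have hinj := (FPMod.mono_iff (kernel.ι p)).1 inferInstance
  exact ⟨LinearEquiv.ofInjective _ hinj ≪≫ₗ LinearEquiv.ofEq _ _ hr⟩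

/-- `Ext¹` vanishes because, by dual exactness, maps into projectives extend along monomorphisms
with Gorenstein projective cokernel; higher Ext groups reduce to this one by passing to Gorenstein
projective syzygies. -/
lemma isCosyzygyClosed_isGorensteinProjective :
    IsCosyzygyClosed (isGorensteinProjective R) where
  ext := by
    suffices ∀ (m : ℕ) (G : FPMod R), isGorensteinProjective R G → ∀ (Q : FPMod R), Projective Q →
        ∀ f : (DerivedCategory.singleFunctor (FPMod R) 0).obj G ⟶
          ((DerivedCategory.singleFunctor (FPMod R) 0).obj Q)⟦(m : ℤ) + 1⟧, f = 0 by
      intro G hG Q hQ n hn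
      obtain ⟨m, rfl⟩ := Int.le.dest (show 1 ≤ n by lia)
      rw [add_comm]
      exact this m G hG Q hQ
    intro m
    induction m with
    | zero =>
      intro G hG Q hQ f
      obtain ⟨K, P, i, p, w, h, hP, hK⟩ := hG.exists_syzygy
      have : Projective (ShortComplex.mk i p w).X₂ := hP
      refine hom_shift_succ_eq_zero h 0 le_rfl (fun g => ?_) f
      let e := (shiftFunctorZero (DerivedCategory (FPMod R)) ℤ).app
        ((DerivedCategory.singleFunctor (FPMod R) 0).obj Q)
      obtain ⟨a, ha⟩ := (DerivedCategory.singleFunctor (FPMod R) 0).map_surjective (g ≫ e.hom)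
      have : Module.Projective R Q.obj := (isProj_iff Q).2 hQ
      have : Module.FinitePresentation R Q.obj := Q.property
      obtain ⟨b, hb⟩ := hG.exists_extension i.hom.hom p.hom.hom ((FPMod.mono_iff _).1 h.mono_f)
        ((FPMod.epi_iff _).1 h.epi_g) ((FPMod.exact_iff _).1 h.exact) a.hom.hom
      obtain ⟨b, rfl⟩ : ∃ b' : P ⟶ Q, b = b'.hom.hom :=
        ⟨ObjectProperty.homMk (ModuleCat.ofHom b), rfl⟩
      have hab : i ≫ b = a := by ext y; exact LinearMap.congr_fun hb y
      refine ⟨(DerivedCategory.singleFunctor (FPMod R) 0).map b ≫ e.inv, ?_⟩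
      rw [← Category.assoc, ← Functor.map_comp, hab, ha, Category.assoc, e.hom_inv_id,
        Category.comp_id]
    | succ m ih =>
      intro G hG Q hQ f
      obtain ⟨K, P, i, p, w, h, hP, hK⟩ := hG.exists_syzygy
      have : Projective (ShortComplex.mk i p w).X₂ := hP
      refine hom_shift_succ_eq_zero h (m + 1 : ℕ) (by lia) (fun g => ⟨0, ?_⟩) f
      rw [comp_zero]
      exact ih K hK Q hQ g
  cosyzygy G hG := by
    obtain ⟨c⟩ := nonempty_cosyzygy ⟨G, hG⟩
    exact ⟨c.I, c.S.obj, c.ι, c.π, c.ι_π, c.shortExact, (isProj_iff _).1 c.projective, c.S.property⟩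

lemma isGorensteinProjective.extVanishAbove {G : FPMod R} (hG : isGorensteinProjective R G) :
    ExtVanishAbove 0 G :=
  isCosyzygyClosed_isGorensteinProjective.ext G hG

/-- By the horseshoe lemma the extensions form a cosyzygy-closed class, and any such class consists
of Gorenstein projectives. -/
lemma isGorensteinProjective.extension {S : ShortComplex (FPMod R)} (hS : S.ShortExact)
    (h₁ : isGorensteinProjective R S.X₁) (h₃ : isGorensteinProjective R S.X₃) :
    isGorensteinProjective R S.X₂ :=
  isCosyzygyClosed_isGorensteinProjective.isExtensionOf.isGorensteinProjective _
    ⟨S, hS, h₁, h₃, rfl⟩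

lemma isGorensteinProjective.of_biprod {X Y : FPMod R} (h : isGorensteinProjective R (X ⊞ Y)) :
    isGorensteinProjective R X :=
  (isCosyzygyClosed_isGorensteinProjective.isSummandOf (by
    rintro _ ⟨S, hS, h₁, h₃, rfl⟩
    exact isGorensteinProjective.extension hS h₁ h₃)).isGorensteinProjective _ ⟨Y, h⟩

lemma isGorensteinProjective.of_projective {P : FPMod R} (hP : Projective P) :
    isGorensteinProjective R P := by
  refine IsCosyzygyClosed.isGorensteinProjective (S := fun P => Projective P)
    ⟨fun P hP => ?_, fun P hP => ?_⟩ P hP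
  · have : Projective P := hP
    exact .of_projective
  · refine ⟨P, 0, 𝟙 P, 0, comp_zero, ?_, hP, (isZero_zero _).projective⟩
    exact { exact := (ShortComplex.exact_iff_epi _ rfl).2 (inferInstanceAs (Epi (𝟙 P)))
            mono_f := inferInstanceAs (Mono (𝟙 P))
            epi_g := ⟨fun _ _ _ => (isZero_zero _).eq_of_src _ _⟩ }

/-- A retraction that holds only up to a map through `P` is an honest retraction from `G ⊞ P`. -/
lemma isGorensteinProjective.of_retract_biprod {X G P : FPMod R}
    (hG : isGorensteinProjective R G) (hP : Projective P) (i : X ⟶ G) (p : G ⟶ X)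
    (a : X ⟶ P) (b : P ⟶ X) (h : i ≫ p + a ≫ b = 𝟙 X) : isGorensteinProjective R X := by
  let s : X ⟶ G ⊞ P := biprod.lift i a
  let r : G ⊞ P ⟶ X := biprod.desc p b
  have hsr : s ≫ r = 𝟙 X := by simp [s, r, h]
  have : IsSplitMono s := ⟨⟨⟨r, hsr⟩⟩⟩
  let S := ShortComplex.mk s (cokernel.π s) (cokernel.condition s)
  have hS : S.Exact := ShortComplex.exact_cokernel s
  let σ : S.Splitting := .ofExactOfRetraction S hS r hsr inferInstance
  have hGP : isGorensteinProjective R (G ⊞ P) :=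
    isGorensteinProjective.extension (ShortComplex.Splitting.ofHasBinaryBiproduct G P).shortExact
      hG (.of_projective hP)
  exact ((isGorensteinProjective R).prop_of_iso σ.isoBinaryBiproduct hGP).of_biprod

end
end SingCat

/-! ### Full faithfulness and exactness of `Phi` -/

namespace SingCat

section
variable {R : Type u} [Ring R] [IsLeftCoherentRing R]
open DerivedCategory Pretriangulated ZeroObject

section
variable {S S₁ S₂ : ShortComplex (FPMod R)} (hS : S.ShortExact) (h₁ : S₁.ShortExact)
  (h₂ : S₂.ShortExact)

/-- The connecting morphism of a short exact sequence, between images of stalk complexes under the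
inclusion of the bounded derived category. -/
noncomputable def derivedδ : Bounded.ι.obj ((stalk R).obj S.X₃) ⟶
    (Bounded.ι.obj ((stalk R).obj S.X₁))⟦(1 : ℤ)⟧ := hS.singleδ

lemma derived_distinguished : Triangle.mk (Bounded.ι.map ((stalk R).map S.f))
    (Bounded.ι.map ((stalk R).map S.g)) (derivedδ hS) ∈ distTriang (DerivedCategory (FPMod R)) :=
  singleTriangle_distinguished hS

lemma derivedδ_naturality (φ : S₁ ⟶ S₂) : Bounded.ι.map ((stalk R).map φ.τ₃) ≫ derivedδ h₂ =
    derivedδ h₁ ≫ (Bounded.ι.map ((stalk R).map φ.τ₁))⟦(1 : ℤ)⟧' :=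
  (ShortComplex.ShortExact.singleTriangle.map h₁ h₂ φ).comm₃.symm

/-- The connecting morphism in the bounded derived category of a short exact sequence. -/
noncomputable def stalkδ : (stalk R).obj S.X₃ ⟶ ((stalk R).obj S.X₁)⟦(1 : ℤ)⟧ :=
  ObjectProperty.homMk
    (derivedδ hS ≫ (Bounded.ι.commShiftIso (1 : ℤ)).inv.app ((stalk R).obj S.X₁))

lemma stalkδ_comp : Bounded.ι.map (stalkδ hS) ≫
    (Bounded.ι.commShiftIso (1 : ℤ)).hom.app ((stalk R).obj S.X₁) = derivedδ hS := by
  have : Bounded.ι.map (stalkδ hS) =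
    derivedδ hS ≫ (Bounded.ι.commShiftIso (1 : ℤ)).inv.app ((stalk R).obj S.X₁) := rfl
  rw [this, Category.assoc, Iso.inv_hom_id_app]
  exact Category.comp_id _

lemma stalk_distinguished : Triangle.mk ((stalk R).map S.f) ((stalk R).map S.g) (stalkδ hS) ∈
    distTriang (Bounded (FPMod R)) := by
  have h : Triangle.mk (Bounded.ι.map ((stalk R).map S.f))
      (Bounded.ι.map ((stalk R).map S.g)) (Bounded.ι.map (stalkδ hS) ≫
        (Bounded.ι.commShiftIso (1 : ℤ)).hom.app ((stalk R).obj S.X₁)) ∈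
      distTriang (DerivedCategory (FPMod R)) := by
    rw [stalkδ_comp]
    exact derived_distinguished hS
  exact h

lemma stalkδ_naturality (φ : S₁ ⟶ S₂) :
    (stalk R).map φ.τ₃ ≫ stalkδ h₂ = stalkδ h₁ ≫ ((stalk R).map φ.τ₁)⟦(1 : ℤ)⟧' := by
  apply Bounded.ι.map_injective
  rw [← cancel_mono ((Bounded.ι.commShiftIso (1 : ℤ)).hom.app ((stalk R).obj S₂.X₁)),
    Functor.map_comp, Functor.map_comp, Category.assoc, Category.assoc, stalkδ_comp,
    Functor.commShiftIso_hom_naturality, ← Category.assoc (Bounded.ι.map (stalkδ h₁)), stalkδ_comp]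
  exact derivedδ_naturality h₁ h₂ φ

/-- The connecting morphism in `D_sg(R)` of a short exact sequence. -/
noncomputable def dsgδ : (moduleToDsg R).obj S.X₃ ⟶ ((moduleToDsg R).obj S.X₁)⟦(1 : ℤ)⟧ :=
  (toDsg R).map (stalkδ hS) ≫ ((toDsg R).commShiftIso (1 : ℤ)).hom.app ((stalk R).obj S.X₁)

lemma dsg_distinguished : Triangle.mk ((moduleToDsg R).map S.f) ((moduleToDsg R).map S.g)
    (dsgδ hS) ∈ distTriang (Dsg R) :=
  (toDsg R).map_distinguished _ (stalk_distinguished hS)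

lemma dsgδ_naturality (φ : S₁ ⟶ S₂) : (moduleToDsg R).map φ.τ₃ ≫ dsgδ h₂ =
    dsgδ h₁ ≫ ((moduleToDsg R).map φ.τ₁)⟦(1 : ℤ)⟧' := by
  have := congrArg (toDsg R).map (stalkδ_naturality h₁ h₂ φ)
  rw [Functor.map_comp, Functor.map_comp] at this
  dsimp only [dsgδ]
  rw [Category.assoc]
  erw [← (toDsg R).commShiftIso_hom_naturality]
  rw [← Category.assoc, ← Category.assoc]
  exact congrArg (· ≫ ((toDsg R).commShiftIso (1 : ℤ)).hom.app ((stalk R).obj S₂.X₁)) this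

lemma isZero_moduleToDsg {P : FPMod R} (hP : Projective P) : IsZero ((moduleToDsg R).obj P) :=
  isZero_toDsg_stalk R P ((isProj_iff P).2 hP)

/-- The middle term becomes zero in `D_sg(R)`; thus syzygies and cosyzygies realize the shifts by
`-1` and `1`. -/
lemma isIso_dsgδ (hP : Projective S.X₂) : IsIso (dsgδ hS) :=
  (Triangle.isZero₂_iff_isIso₃ _ (dsg_distinguished hS)).1 (isZero_moduleToDsg hP)

end

instance : (toStable R).Additive := CategoryTheory.Quotient.functor_additive _ _

instance : (GprojToDsg R).Additive := by
  dsimp only [GprojToDsg]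
  infer_instance

instance : (Phi R).Additive := by
  have : (toStable R ⋙ Phi R).Additive := inferInstanceAs (GprojToDsg R).Additive
  exact Functor.additive_of_full_essSurj_comp (toStable R) (Phi R)

instance : (Phi R).Full where
  map_surjective {X Y} φ := by
    obtain ⟨f, hf⟩ := X.as.property.extVanishAbove.exists_map_eq (Y := Y.as.obj) φ
    exact ⟨(toStable R).map (ObjectProperty.homMk f), hf⟩

instance : (Phi R).Faithful where
  map_injective {X Y} f g h := by
    obtain ⟨f, rfl⟩ := (toStable R).map_surjective f
    obtain ⟨g, rfl⟩ := (toStable R).map_surjective g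
    refine CategoryTheory.Quotient.sound _
      (X.as.property.extVanishAbove.factorsThroughProj (f.hom - g.hom) ?_)
    rw [Functor.map_sub, sub_eq_zero]
    exact h

/-- The isomorphism `L(S(X)) ≅ L(X)[1]` given by the connecting morphism, with a sign. -/
noncomputable def suspensionIso (X : Gproj R) :
    (moduleToDsg R).obj (cosyzygy X).S.obj ≅ ((moduleToDsg R).obj X.obj)⟦(1 : ℤ)⟧ :=
  have := isIso_dsgδ (cosyzygy X).shortExact ((isProj_iff _).1 (cosyzygy X).projective)
  { hom := -dsgδ (cosyzygy X).shortExact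
    inv := -inv (dsgδ (cosyzygy X).shortExact)
    hom_inv_id := by rw [Preadditive.neg_comp_neg, IsIso.hom_inv_id]
    inv_hom_id := by rw [Preadditive.neg_comp_neg, IsIso.inv_hom_id] }

lemma suspensionIso_hom (X : Gproj R) :
    (suspensionIso X).hom = -dsgδ (cosyzygy X).shortExact := rfl

lemma suspensionIso_naturality {X Y : Gproj R} (f : X ⟶ Y) :
    (moduleToDsg R).map (cosyzygyMap f).hom ≫ (suspensionIso Y).hom =
      (suspensionIso X).hom ≫ ((moduleToDsg R).map f.hom)⟦(1 : ℤ)⟧' := by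
  obtain ⟨g, hg, hg'⟩ := cosyzygyMap_spec f
  have := dsgδ_naturality (cosyzygy X).shortExact (cosyzygy Y).shortExact
    { τ₁ := f.hom, τ₂ := g, τ₃ := (cosyzygyMap f).hom, comm₁₂ := hg.symm, comm₂₃ := hg'.symm }
  rw [suspensionIso_hom, suspensionIso_hom, Preadditive.comp_neg, Preadditive.neg_comp, this]

/-- The compatibility of `Φ_R` with suspensions. -/
noncomputable def phiSuspensionIso :
    stableSuspension R ⋙ Phi R ≅ Phi R ⋙ shiftFunctor (Dsg R) (1 : ℤ) :=
  NatIso.ofComponents (fun X => suspensionIso X.as) (fun {X Y} f => by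
    obtain ⟨f, rfl⟩ := (toStable R).map_surjective f
    exact suspensionIso_naturality f)

/-- Pushing out the monomorphism `X ⟶ I(X)` gives a monomorphism with the same cokernel. -/
lemma shortExact_of_isPushout {X : Gproj R} {Y Z : FPMod R} {u : X.obj ⟶ Y} {v : Y ⟶ Z}
    {w : Z ⟶ (cosyzygy X).S.obj} {j : (cosyzygy X).I ⟶ Z}
    (h : IsPushout u (cosyzygy X).ι v j) (hv : v ≫ w = 0)
    (hj : j ≫ w = (cosyzygy X).π) : (ShortComplex.mk v w hv).ShortExact := by
  have hc := (cosyzygy X).shortExact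
  have hι : Mono (cosyzygy X).ι := hc.mono_f
  have : Epi (cosyzygy X).π := hc.epi_g
  have : Epi w := epi_of_epi_fac hj
  have : Mono v :=
    (MorphismProperty.monomorphisms (FPMod R)).of_isPushout h hι
  have hdesc {W : FPMod R} (k : Z ⟶ W) (hk : v ≫ k = 0) : ∃ l, w ≫ l = k := by
    obtain ⟨l, hl⟩ := (cosyzygy X).exists_desc (j ≫ k) (by rw [← h.w_assoc, hk, comp_zero])
    refine ⟨l, h.hom_ext ?_ ?_⟩
    · rw [reassoc_of% hv, zero_comp, hk]
    · rw [reassoc_of% hj, hl]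
  have hcok : IsColimit (CokernelCofork.ofπ w hv) :=
    CokernelCofork.IsColimit.ofπ' _ _ fun k hk => ⟨(hdesc k hk).choose, (hdesc k hk).choose_spec⟩
  exact { exact := ShortComplex.exact_of_g_is_cokernel (ShortComplex.mk v w hv) hcok }

/-- By naturality the connecting morphism of `0 ⟶ Y ⟶ Z ⟶ S(X) ⟶ 0` is that of the conflation of `X`
followed by `u[1]`. The rotated triangle ends in `-u[1]`, which forces the sign in `suspensionIso`.
-/
lemma IsStandardTriangle.distinguished {X Y Z : Gproj R} {u : X ⟶ Y} {v : Y ⟶ Z}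
    {w : Z ⟶ (cosyzygy X).S} (h : IsStandardTriangle u v w) :
    Triangle.mk ((moduleToDsg R).map u.hom) ((moduleToDsg R).map v.hom)
      ((moduleToDsg R).map w.hom ≫ (suspensionIso X).hom) ∈ distTriang (Dsg R) := by
  obtain ⟨j, hj, hvw, hjw⟩ := h
  have hS := shortExact_of_isPushout hj hvw hjw
  have hδ := dsgδ_naturality (cosyzygy X).shortExact hS
    { τ₁ := u.hom, τ₂ := j, τ₃ := 𝟙 _, comm₁₂ := hj.w, comm₂₃ := by simp [hjw] }
  rw [rotate_distinguished_triangle]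
  refine isomorphic_distinguished _ (dsg_distinguished hS) _
    (Triangle.isoMk _ _ (Iso.refl _) (Iso.refl _) (suspensionIso X).symm ?_ ?_ ?_)
  · exact (Category.comp_id _).trans (Category.id_comp _).symm
  · change ((moduleToDsg R).map w.hom ≫ (suspensionIso X).hom) ≫ (suspensionIso X).inv =
      𝟙 _ ≫ (moduleToDsg R).map w.hom
    simp
  · change (-((moduleToDsg R).map u.hom)⟦(1 : ℤ)⟧') ≫ (𝟙 _)⟦(1 : ℤ)⟧' =
      (suspensionIso X).inv ≫ dsgδ hS
    rw [CategoryTheory.Functor.map_id, Category.comp_id, Iso.eq_inv_comp, suspensionIso_hom,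
      Preadditive.neg_comp_neg]
    refine hδ.symm.trans ?_
    change (moduleToDsg R).map (𝟙 _) ≫ _ = _
    rw [CategoryTheory.Functor.map_id, Category.id_comp]

lemma isTriangleFunctor_phi : IsTriangleFunctor R (Phi R) := by
  refine ⟨inferInstance, phiSuspensionIso, ?_⟩
  rintro X Y Z u v w ⟨X', Y', Z', u', v', w', a, b, c, h, hu, hv, hw⟩
  refine isomorphic_distinguished _ h.distinguished _
    (Triangle.isoMk _ _ ((Phi R).mapIso a) ((Phi R).mapIso b) ((Phi R).mapIso c) ?_ ?_ ?_)
  · exact ((Phi R).map_comp _ _).symm.trans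
      ((congrArg (Phi R).map hu).trans ((Phi R).map_comp _ _))
  · exact ((Phi R).map_comp _ _).symm.trans
      ((congrArg (Phi R).map hv).trans ((Phi R).map_comp _ _))
  · have hn := phiSuspensionIso.hom.naturality a.hom
    have hw' : (Phi R).map w ≫ (Phi R).map ((stableSuspension R).map a.hom) =
        (Phi R).map c.hom ≫ (Phi R).map ((toStable R).map w') :=
      ((Phi R).map_comp _ _).symm.trans
        ((congrArg (Phi R).map hw).trans ((Phi R).map_comp _ _))
    exact (Category.assoc _ _ _).trans ((congrArg ((Phi R).map w ≫ ·) hn.symm).trans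
      ((Category.assoc _ _ _).symm.trans ((congrArg (· ≫ (suspensionIso X').hom) hw').trans
        (Category.assoc _ _ _))))

end
end SingCat

/-! ### Density up to summands implies G-regularity -/

namespace SingCat

section
variable {R : Type u} [Ring R] [IsLeftCoherentRing R]
open DerivedCategory Pretriangulated ZeroObject

lemma ExtVanishAbove.bounded_hom_eq_zero {X Q : FPMod R} {m n : ℤ} (hX : ExtVanishAbove m X)
    (hQ : Projective Q) (hn : m < n) (f : (stalk R).obj X ⟶ ((stalk R).obj Q)⟦n⟧) : f = 0 :=
  bounded_hom_shift_eq_zero (P := (stalk R).obj X) n (hX Q hQ n hn) f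

lemma extVanishAbove_of_bounded {X : FPMod R} {m : ℤ}
    (h : ∀ (Q : FPMod R) (_ : Projective Q) (n : ℤ), m < n →
      ∀ f : (stalk R).obj X ⟶ ((stalk R).obj Q)⟦n⟧, f = 0) : ExtVanishAbove m X := by
  intro Q hQ n hn f
  let f' : Bounded.ι.obj ((stalk R).obj X) ⟶ (Bounded.ι.obj ((stalk R).obj Q))⟦n⟧ := f
  let g : (stalk R).obj X ⟶ ((stalk R).obj Q)⟦n⟧ :=
    ObjectProperty.homMk (f' ≫ (Bounded.ι.commShiftIso n).inv.app ((stalk R).obj Q))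
  have hg : f' ≫ (Bounded.ι.commShiftIso n).inv.app ((stalk R).obj Q) = 0 :=
    congrArg Bounded.ι.map (h Q hQ n hn g)
  change f' = 0
  rwa [← cancel_mono ((Bounded.ι.commShiftIso n).inv.app ((stalk R).obj Q)), zero_comp]

lemma exists_hom_shift_eq_zero_of_perfect {P : Bounded (FPMod R)} (hP : isPerfectBounded R P) :
    ∃ m : ℤ, ∀ (Y : FPMod R) (n : ℤ), m < n → ∀ f : P ⟶ ((stalk R).obj Y)⟦n⟧, f = 0 := by
  obtain ⟨K, a, b, ha, hb, hK, ⟨e⟩⟩ := (isPerfectBounded_iff P).1 hP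
  refine ⟨-a, fun Y n hn => bounded_hom_shift_eq_zero n fun f => ?_⟩
  rw [← cancel_epi e.inv, comp_zero]
  exact hom_shift_eq_zero K b n (K.isZero_of_isStrictlyGE a _ (by lia)) Y _

/-- A module which is a direct summand of a Gorenstein projective module in `D_sg(R)` has
vanishing `Extⁿ` with values in projective modules for large `n`. -/
lemma exists_extVanishAbove_of_retract {M G : FPMod R} (hG : isGorensteinProjective R G)
    (r : Retract ((moduleToDsg R).obj M) ((moduleToDsg R).obj G)) :
    ∃ n : ℕ, ExtVanishAbove (n : ℤ) M := by
  let W := (isPerfectBounded R).trW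
  obtain ⟨φ, hφ⟩ := Localization.exists_rightFraction (toDsg R) W
    (X := (stalk R).obj M) (Y := (stalk R).obj G) r.i
  obtain ⟨ψ, hψ⟩ := Localization.exists_leftFraction (toDsg R) W
    (X := (stalk R).obj G) (Y := (stalk R).obj M) r.r
  -- With the section as a right fraction and the retraction as a left one, `r.retract` becomes an
  -- equality of two maps of the bounded derived category after postcomposition with some `t`; one
  -- of them passes through `G`.
  have h : (toDsg R).map (φ.f ≫ ψ.f) = (toDsg R).map (φ.s ≫ ψ.s) := by
    have h₁ := φ.map_s_comp_map (toDsg R) (Localization.inverts (toDsg R) W)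
    have h₂ := ψ.map_comp_map_s (toDsg R) (Localization.inverts (toDsg R) W)
    rw [← hφ] at h₁
    rw [← hψ] at h₂
    rw [Functor.map_comp, Functor.map_comp, ← h₁, ← h₂, Category.assoc]
    congr 1
    exact (Category.assoc _ _ _).symm.trans
      ((congrArg (· ≫ (toDsg R).map ψ.s) r.retract).trans (Category.id_comp _))
  obtain ⟨V, t, ht, h⟩ := (MorphismProperty.map_eq_iff_postcomp (toDsg R) W _ _).1 h
  rw [Category.assoc, Category.assoc] at h
  obtain ⟨P, a, b, hT, hP⟩ := ((isPerfectBounded R).trW_iff' _).1 (W.comp_mem _ _ ψ.hs ht)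
  obtain ⟨P', a', b', hT', hP'⟩ := φ.hs
  obtain ⟨m, hm⟩ := exists_hom_shift_eq_zero_of_perfect hP
  obtain ⟨m', hm'⟩ := exists_hom_shift_eq_zero_of_perfect hP'
  refine ⟨(max m m').toNat, extVanishAbove_of_bounded fun Q hQ n hn f => ?_⟩
  -- For large `n`, `f` extends along `ψ.s ≫ t`, whose fibre is perfect. The composite from `G` is
  -- zero, so precomposing `f` with `φ.s` gives zero and `f` factors through the perfect cone of
  -- `φ.s`, which has no maps to `Q[n]`.
  obtain ⟨k, rfl⟩ := desc₂_of_distTriang hT f (hm Q n (by lia) _)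
  have h0 : (ψ.f ≫ t) ≫ k = 0 := hG.extVanishAbove.bounded_hom_eq_zero hQ (by lia) _
  obtain ⟨l, hl⟩ := desc₂_of_distTriang hT' ((ψ.s ≫ t) ≫ k) (by
    rw [← Category.assoc, ← h, Category.assoc, h0, comp_zero])
  rw [hl, hm' Q n (by lia) l, comp_zero]

lemma gpdLE_of_isZero {M : FPMod R} (hM : IsZero M) : GpdLE M 0 := by
  have hz : IsZero (0 : FPMod R) := isZero_zero _
  have hsub (X : FPMod R) (hX : IsZero X) (x : X.obj) : x = 0 :=
    LinearMap.congr_fun (congrArg (fun f => f.hom.hom) (hX.eq_of_src (𝟙 X) 0)) x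
  have h0 (X Y Z : FPMod R) (hY : IsZero Y) (f : X ⟶ Y) (g : Y ⟶ Z) :
      Function.Exact f.hom.hom g.hom.hom := fun y => by
    rw [hsub _ hY y]
    exact ⟨fun _ => ⟨0, map_zero _⟩, fun _ => map_zero _⟩
  have hX (i : ℕ) : IsZero ((0 : ChainComplex (FPMod R) ℕ).X i) :=
    (HomologicalComplex.eval _ _ i).map_isZero (isZero_zero _)
  exact ⟨0, 0, fun i => .of_projective (hX i).projective, fun i _ => hX i,
    fun y => ⟨0, (map_zero _).trans (hsub _ hM y).symm⟩, h0 _ _ _ (hX 0) _ _,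
    fun i => h0 _ _ _ (hX (i + 1)) _ _⟩

/-- A resolution of the kernel is spliced with the middle term, which becomes the new degree zero.
-/
lemma GpdLE.of_shortExact {S : ShortComplex (FPMod R)} (hS : S.ShortExact)
    (h₂ : isGorensteinProjective R S.X₂) {n : ℕ} (h₁ : GpdLE S.X₁ n) : GpdLE S.X₃ (n + 1) := by
  obtain ⟨C, ε, hC, hn, hε, hε', hex⟩ := h₁
  have hinj := (FPMod.mono_iff S.f).1 hS.mono_f
  have hexS := (FPMod.exact_iff S).1 hS.exact
  have hw : C.d 1 0 ≫ ε ≫ S.f = 0 := by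
    ext x
    change S.f.hom.hom (ε.hom.hom ((C.d 1 0).hom.hom x)) = 0
    rw [hε'.apply_apply_eq_zero, map_zero]
  refine ⟨C.augment (ε ≫ S.f) hw, S.g, ?_, ?_, (FPMod.epi_iff S.g).1 hS.epi_g, ?_, ?_⟩
  · rintro (_ | i)
    · exact h₂
    · exact hC i
  · rintro (_ | i) hi
    · lia
    · exact hn i (by lia)
  · intro y
    refine (hexS y).trans ?_
    constructor
    · rintro ⟨x, rfl⟩
      obtain ⟨z, rfl⟩ := hε x
      exact ⟨z, rfl⟩
    · rintro ⟨z, rfl⟩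
      exact ⟨ε.hom.hom z, rfl⟩
  · rintro (_ | i)
    · intro y
      refine Iff.trans ?_ (hε' y)
      exact map_eq_zero_iff _ hinj
    · exact hex i

/-- The syzygies of a direct summand in `D_sg(R)` are direct summands of the syzygies. -/
lemma nonempty_retract_of_shortExact {S T : ShortComplex (FPMod R)} (hS : S.ShortExact)
    (hT : T.ShortExact) (hS₂ : Projective S.X₂) (hT₂ : Projective T.X₂)
    (r : Retract ((moduleToDsg R).obj S.X₃) ((moduleToDsg R).obj T.X₃)) :
    Nonempty (Retract ((moduleToDsg R).obj S.X₁) ((moduleToDsg R).obj T.X₁)) := by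
  have := isIso_dsgδ hS hS₂
  have := isIso_dsgδ hT hT₂
  obtain ⟨i, hi⟩ := (shiftFunctor (Dsg R) (1 : ℤ)).map_surjective (inv (dsgδ hS) ≫ r.i ≫ dsgδ hT)
  obtain ⟨p, hp⟩ := (shiftFunctor (Dsg R) (1 : ℤ)).map_surjective (inv (dsgδ hT) ≫ r.r ≫ dsgδ hS)
  refine ⟨i, p, (shiftFunctor (Dsg R) (1 : ℤ)).map_injective ?_⟩
  rw [Functor.map_comp, hi, hp, CategoryTheory.Functor.map_id]
  simp

/-- Each syzygy lowers the Ext bound and preserves the retraction in `D_sg(R)`. At bound zero the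
retraction lifts to module maps up to a map through a projective, so the module is Gorenstein
projective. -/
lemma exists_gpdLE_of_retract (n : ℕ) : ∀ {M G : FPMod R} (_ : ExtVanishAbove (n : ℤ) M)
    (_ : isGorensteinProjective R G)
    (_ : Retract ((moduleToDsg R).obj M) ((moduleToDsg R).obj G)), ∃ n, GpdLE M n := by
  induction n with
  | zero =>
    intro M G hM hG r
    obtain ⟨i, hi⟩ := hM.exists_map_eq r.i
    obtain ⟨p, hp⟩ := hG.extVanishAbove.exists_map_eq r.r
    obtain ⟨P, hP, a, b, hab⟩ := hM.factorsThroughProj (𝟙 M - i ≫ p) (by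
      rw [Functor.map_sub, Functor.map_comp, hi, hp, r.retract, CategoryTheory.Functor.map_id,
        sub_self])
    have hM' : isGorensteinProjective R M :=
      .of_retract_biprod hG ((isProj_iff P).1 hP) i p a b (by rw [hab]; abel)
    have hS : (ShortComplex.mk (0 : 0 ⟶ M) (𝟙 M) zero_comp).ShortExact :=
      { exact := (ShortComplex.exact_iff_mono _ rfl).2 (inferInstanceAs (Mono (𝟙 M)))
        mono_f := ⟨fun _ _ _ => (isZero_zero _).eq_of_tgt _ _⟩
        epi_g := inferInstanceAs (Epi (𝟙 M)) }
    -- The bound `1` is not sharp: it comes from splicing `M` with a resolution of zero, and only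
    -- finiteness matters.
    exact ⟨1, GpdLE.of_shortExact hS hM' (gpdLE_of_isZero (isZero_zero _))⟩
  | succ n ih =>
    intro M G hM hG r
    obtain ⟨K, P, i, p, w, h, hP⟩ := FPMod.exists_syzygy M
    obtain ⟨K', P', i', p', w', h', hP', hK'⟩ := hG.exists_syzygy
    have : Projective (ShortComplex.mk i p w).X₂ := hP
    obtain ⟨r'⟩ := nonempty_retract_of_shortExact h h' hP hP' r
    obtain ⟨m, hm⟩ := ih (ExtVanishAbove.syzygy h (by lia) (by exact_mod_cast hM)) hK' r'
    exact ⟨m + 1, GpdLE.of_shortExact h (.of_projective hP) hm⟩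

lemma DenseUpToSummands.isLeftGRegular (h : DenseUpToSummands R (Phi R)) : IsLeftGRegular R := by
  intro M
  obtain ⟨G, Y, ⟨e⟩⟩ := h ((moduleToDsg R).obj M)
  let e' : (moduleToDsg R).obj G.as.obj ≅ (moduleToDsg R).obj M ⊞ Y := e
  let r : Retract ((moduleToDsg R).obj M) ((moduleToDsg R).obj G.as.obj) :=
    { i := biprod.inl ≫ e'.inv
      r := e'.hom ≫ biprod.fst
      retract := by
        rw [Category.assoc, e'.inv_hom_id_assoc, biprod.inl_fst] }
  obtain ⟨n, hn⟩ := exists_extVanishAbove_of_retract G.as.property r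
  exact exists_gpdLE_of_retract n hn G.as.property r

end
end SingCat

/-! ### G-regularity implies density -/

namespace SingCat

section
variable {R : Type u} [Ring R] [IsLeftCoherentRing R]
open DerivedCategory Pretriangulated ZeroObject

/-- A property of modules which holds for Gorenstein projective modules and for cokernels of
monomorphisms holds for modules of finite Gorenstein projective dimension. -/
lemma GpdLE.induction {T : ObjectProperty (FPMod R)} (hG : isGorensteinProjective R ≤ T)
    (hT : ∀ S : ShortComplex (FPMod R), S.ShortExact → T S.X₁ → T S.X₂ → T S.X₃) (n : ℕ) :
    ∀ {M : FPMod R}, GpdLE M n → T M := by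
  induction n with
  | zero =>
    rintro M ⟨C, ε, hC, hn, hε, hex, -⟩
    have : Epi ε := (FPMod.epi_iff ε).2 hε
    have hd : C.d 1 0 = 0 := (hn 1 (by lia)).eq_of_src _ _
    have hS : (ShortComplex.mk (C.d 1 0) ε (by rw [hd, zero_comp])).ShortExact :=
      { exact := (FPMod.exact_iff _).2 hex
        mono_f := ⟨fun _ _ _ => (hn 1 (by lia)).eq_of_tgt _ _⟩
        epi_g := this }
    exact hT _ hS (hG _ (hC 1)) (hG _ (hC 0))
  | succ n ih =>
    rintro M ⟨C, ε, hC, hn, hε, hex₀, hex⟩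
    have : Epi ε := (FPMod.epi_iff ε).2 hε
    have hS : (ShortComplex.mk (kernel.ι ε) ε (kernel.condition ε)).ShortExact :=
      { exact := ShortComplex.exact_of_f_is_kernel _ (kernelIsKernel ε) }
    -- Dropping `C.X 0` leaves a resolution, shorter by one, of the kernel of `ε`.
    refine hT _ hS (ih ?_) (hG _ (hC 0))
    have hinj := (FPMod.mono_iff _).1 hS.mono_f
    have hker := (FPMod.exact_iff _).1 hS.exact
    have hw : C.d 1 0 ≫ ε = 0 := by ext x; exact hex₀.apply_apply_eq_zero x
    have hl (x) : (kernel.ι ε).hom.hom ((kernel.lift ε (C.d 1 0) hw).hom.hom x) =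
      (C.d 1 0).hom.hom x :=
      LinearMap.congr_fun (congrArg (fun f => f.hom.hom) (kernel.lift_ι ε (C.d 1 0) hw)) x
    refine ⟨(ChainComplex.truncate).obj C, kernel.lift ε (C.d 1 0) hw, fun i => hC (i + 1),
      fun i hi => hn (i + 1) (by lia), fun y => ?_, fun y => ?_, fun i => hex (i + 1)⟩
    · obtain ⟨x, hx⟩ := (hex₀ ((kernel.ι ε).hom.hom y)).1 (hker.apply_apply_eq_zero y)
      exact ⟨x, hinj ((hl x).trans hx)⟩
    · refine Iff.trans ?_ (hex 0 y)
      exact (map_eq_zero_iff _ hinj).symm.trans (iff_of_eq (congrArg (· = 0) (hl y)))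

variable (R) in
/-- The objects of `D_sg(R)` isomorphic to Gorenstein projective modules. -/
def IsGorensteinObject : ObjectProperty (Dsg R) := fun X =>
  ∃ G : FPMod R, isGorensteinProjective R G ∧ Nonempty ((moduleToDsg R).obj G ≅ X)

instance : (IsGorensteinObject R).IsClosedUnderIsomorphisms where
  of_iso := by
    rintro X Y e ⟨G, hG, ⟨e'⟩⟩
    exact ⟨G, hG, ⟨e' ≪≫ e⟩⟩

lemma IsGorensteinObject.shift_one {X : Dsg R} (hX : IsGorensteinObject R X) :
    IsGorensteinObject R (X⟦(1 : ℤ)⟧) := by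
  obtain ⟨G, hG, ⟨e⟩⟩ := hX
  exact ⟨_, (cosyzygy ⟨G, hG⟩).S.property, ⟨suspensionIso ⟨G, hG⟩ ≪≫ (shiftFunctor _ _).mapIso e⟩⟩

lemma IsGorensteinObject.shift_neg_one {X : Dsg R} (hX : IsGorensteinObject R X) :
    IsGorensteinObject R (X⟦(-1 : ℤ)⟧) := by
  obtain ⟨G, hG, ⟨e⟩⟩ := hX
  obtain ⟨K, P, i, p, w, h, hP, hK⟩ := hG.exists_syzygy
  have := isIso_dsgδ h hP
  exact ⟨K, hK, ⟨(shiftShiftNeg ((moduleToDsg R).obj K) (1 : ℤ)).symm ≪≫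
    (shiftFunctor (Dsg R) (-1 : ℤ)).mapIso ((asIso (dsgδ h)).symm ≪≫ e)⟩⟩

lemma IsGorensteinObject.of_isZero {X : Dsg R} (hX : IsZero X) : IsGorensteinObject R X :=
  ⟨0, .of_projective (isZero_zero _).projective,
    ⟨(isZero_moduleToDsg (isZero_zero _).projective).iso hX⟩⟩

/-- The first map lifts to a module homomorphism `u : X ⟶ Y`, and its cone is the pushout of `u`
along `X ⟶ I(X)`, an extension of `S(X)` by `Y` and hence Gorenstein projective. -/
lemma IsGorensteinObject.obj₃ {T : Triangle (Dsg R)} (hT : T ∈ distTriang (Dsg R))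
    (h₁ : IsGorensteinObject R T.obj₁) (h₂ : IsGorensteinObject R T.obj₂) :
    IsGorensteinObject R T.obj₃ := by
  obtain ⟨X, hX, ⟨e₁⟩⟩ := h₁
  obtain ⟨Y, hY, ⟨e₂⟩⟩ := h₂
  obtain ⟨u, hu⟩ := hX.extVanishAbove.exists_map_eq (e₁.hom ≫ T.mor₁ ≫ e₂.inv)
  let c := cosyzygy ⟨X, hX⟩
  have hp := IsPushout.of_hasPushout u c.ι
  let w : pushout u c.ι ⟶ c.S.obj := pushout.desc 0 c.π (by rw [comp_zero, c.ι_π])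
  have hS := shortExact_of_isPushout (X := ⟨X, hX⟩) hp (w := w) (pushout.inl_desc _ _ _)
    (pushout.inr_desc _ _ _)
  have hZ : isGorensteinProjective R (pushout u c.ι) :=
    isGorensteinProjective.extension hS hY c.S.property
  have hst : IsStandardTriangle (X := ⟨X, hX⟩) (Y := ⟨Y, hY⟩) (Z := ⟨_, hZ⟩)
      (ObjectProperty.homMk u) (ObjectProperty.homMk (pushout.inl u c.ι))
      (ObjectProperty.homMk w) :=
    ⟨pushout.inr u c.ι, hp, pushout.inl_desc _ _ _, pushout.inr_desc _ _ _⟩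
  refine ⟨_, hZ, ⟨Triangle.π₃.mapIso (isoTriangleOfIso₁₂ _ _ hst.distinguished hT e₁ e₂ ?_)⟩⟩
  change (moduleToDsg R).map u ≫ e₂.hom = e₁.hom ≫ T.mor₁
  rw [hu]
  simp

lemma IsGorensteinObject.obj₂ {T : Triangle (Dsg R)} (hT : T ∈ distTriang (Dsg R))
    (h₁ : IsGorensteinObject R T.obj₁) (h₃ : IsGorensteinObject R T.obj₃) :
    IsGorensteinObject R T.obj₂ :=
  IsGorensteinObject.obj₃ (inv_rot_of_distTriang T hT) h₃.shift_neg_one h₁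

lemma IsGorensteinObject.shift {X : Dsg R} (hX : IsGorensteinObject R X) (n : ℤ) :
    IsGorensteinObject R (X⟦n⟧) := by
  induction n with
  | zero => exact (IsGorensteinObject R).prop_of_iso ((shiftFunctorZero (Dsg R) ℤ).app X).symm hX
  | succ n ih =>
    exact (IsGorensteinObject R).prop_of_iso
      ((shiftFunctorAdd' (Dsg R) (n : ℤ) 1 _ rfl).app X).symm ih.shift_one
  | pred n ih =>
    exact (IsGorensteinObject R).prop_of_iso
      ((shiftFunctorAdd' (Dsg R) (-n : ℤ) (-1) _ rfl).app X).symm ih.shift_neg_one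

lemma IsLeftGRegular.isGorensteinObject_module (hR : IsLeftGRegular R) (M : FPMod R) :
    IsGorensteinObject R ((moduleToDsg R).obj M) := by
  obtain ⟨n, hn⟩ := hR M
  exact GpdLE.induction (T := fun M => IsGorensteinObject R ((moduleToDsg R).obj M))
    (fun G hG => ⟨G, hG, ⟨Iso.refl _⟩⟩)
    (fun S hS h₁ h₂ => IsGorensteinObject.obj₃ (dsg_distinguished hS) h₁ h₂) n hn

/-- The lift of a distinguished triangle to the bounded derived category. -/
lemma exists_bounded_distinguished {X Y Z : Bounded (FPMod R)}
    {f : Bounded.ι.obj X ⟶ Bounded.ι.obj Y} {g : Bounded.ι.obj Y ⟶ Bounded.ι.obj Z}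
    {h : Bounded.ι.obj Z ⟶ (Bounded.ι.obj X)⟦(1 : ℤ)⟧}
    (hT : Triangle.mk f g h ∈ distTriang (DerivedCategory (FPMod R))) :
    ∃ (f' : X ⟶ Y) (g' : Y ⟶ Z) (h' : Z ⟶ X⟦(1 : ℤ)⟧),
      Triangle.mk f' g' h' ∈ distTriang (Bounded (FPMod R)) := by
  let h' : Z ⟶ X⟦(1 : ℤ)⟧ :=
    ObjectProperty.homMk (h ≫ (Bounded.ι.commShiftIso (1 : ℤ)).inv.app X)
  have hh' : Bounded.ι.map h' ≫ (Bounded.ι.commShiftIso (1 : ℤ)).hom.app X = h := by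
    have : Bounded.ι.map h' = h ≫ (Bounded.ι.commShiftIso (1 : ℤ)).inv.app X := rfl
    rw [this, Category.assoc, Iso.inv_hom_id_app]
    exact Category.comp_id _
  refine ⟨ObjectProperty.homMk f, ObjectProperty.homMk g, h', ?_⟩
  have : Triangle.mk f g (Bounded.ι.map h' ≫ (Bounded.ι.commShiftIso (1 : ℤ)).hom.app X) ∈
      distTriang (DerivedCategory (FPMod R)) := by rwa [hh']
  exact this

/-- Induction on the number `d` of degrees allowed: brutal truncation places `K` in a triangle
between a shorter complex and a shift of the module `K.X a`. -/
lemma IsLeftGRegular.isGorensteinObject (hR : IsLeftGRegular R) (d : ℕ) :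
    ∀ (K : CochainComplex (FPMod R) ℤ) (a b : ℤ) (_ : b < a + d) (_ : K.IsStrictlyGE a)
      (_ : K.IsStrictlyLE b), IsGorensteinObject R ((toDsg R).obj (toBounded K a b)) := by
  induction d with
  | zero =>
    intro K a b hab _ _
    have hK : IsZero K := by
      rw [IsZero.iff_id_eq_zero]
      refine HomologicalComplex.hom_ext _ _ fun i => ?_
      by_cases hi : i < a
      · exact (K.isZero_of_isStrictlyGE a i hi).eq_of_src _ _
      · exact (K.isZero_of_isStrictlyLE b i (by simp at hab; lia)).eq_of_src _ _
    have hQ : IsZero (Bounded.ι.obj (toBounded K a b)) := DerivedCategory.Q.map_isZero hK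
    have hB : IsZero (toBounded K a b) := by
      rw [IsZero.iff_id_eq_zero]
      exact Bounded.ι.map_injective (hQ.eq_of_src _ _)
    exact .of_isZero ((toDsg R).map_isZero hB)
  | succ d ih =>
    intro K a b hab _ _
    obtain ⟨K', i, p, δ, h₁, h₂, -, hT⟩ := exists_brutal_truncation K a b
    -- The stalk complex in degree `a` is replaced by a shift of the one in degree zero, so that the
    -- triangle lives in the bounded derived category and the statement for modules applies.
    let Z : Bounded (FPMod R) := ((stalk R).obj (K.X a))⟦-a⟧
    let e : Bounded.ι.obj Z ≅ (singleFunctor (FPMod R) a).obj (K.X a) :=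
      (Bounded.ι.commShiftIso (-a)).app ((stalk R).obj (K.X a)) ≪≫
        ((singleFunctors (FPMod R)).shiftIso (-a) a 0 (by lia)).app (K.X a)
    have hT' : Triangle.mk (Z := Bounded.ι.obj Z) i (p ≫ e.inv) (e.hom ≫ δ) ∈
        distTriang (DerivedCategory (FPMod R)) :=
      isomorphic_distinguished _ hT _
        (Triangle.isoMk _ _ (Iso.refl _) (Iso.refl _) e
          ((Category.comp_id _).trans (Category.id_comp _).symm)
          (by
            change (p ≫ e.inv) ≫ e.hom = 𝟙 _ ≫ p
            rw [Category.assoc, e.inv_hom_id, Category.comp_id, Category.id_comp])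
          (by
            change (e.hom ≫ δ) ≫ (shiftFunctor _ (1 : ℤ)).map (𝟙 _) = e.hom ≫ δ
            rw [CategoryTheory.Functor.map_id, Category.comp_id]))
    obtain ⟨f', g', h', hT''⟩ := exists_bounded_distinguished
      (X := toBounded K' (a + 1) b) (Y := toBounded K a b) (Z := Z) hT'
    refine IsGorensteinObject.obj₂ ((toDsg R).map_distinguished _ hT'') ?_ ?_
    · exact ih K' (a + 1) b (by push_cast at hab; lia) h₁ h₂
    · exact (IsGorensteinObject R).prop_of_iso
        (((toDsg R).commShiftIso (-a)).app ((stalk R).obj (K.X a))).symm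
        ((hR.isGorensteinObject_module (K.X a)).shift (-a))

lemma IsLeftGRegular.essSurj_phi (hR : IsLeftGRegular R) : (Phi R).EssSurj where
  mem_essImage Y := by
    have := Localization.essSurj (toDsg R) (isPerfectBounded R).trW
    let X := (toDsg R).objPreimage Y
    obtain ⟨⟨a, ha⟩, ⟨b, hb⟩⟩ := X.property
    obtain ⟨K, h₁, h₂, ⟨e⟩⟩ := exists_iso_Q_obj_of_isGE_of_isLE X.obj a b
    let e' : toBounded K a b ≅ X := Bounded.ι.preimageIso e.symm
    -- `b + 1 - a` is the number of degrees in `[a, b]`; if this is negative, `toNat` gives zero and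
    -- `K` is zero.
    obtain ⟨G, hG, ⟨e''⟩⟩ := hR.isGorensteinObject (b + 1 - a).toNat K a b (by lia) h₁ h₂
    exact ⟨(toStable R).obj ⟨G, hG⟩,
      ⟨e'' ≪≫ (toDsg R).mapIso e' ≪≫ (toDsg R).objObjPreimageIso Y⟩⟩

lemma denseUpToSummands_of_essSurj [(Phi R).EssSurj] : DenseUpToSummands R (Phi R) := fun X =>
  ⟨(Phi R).objPreimage X, 0, ⟨(Phi R).objObjPreimageIso X ≪≫ isoBiprodZero (isZero_zero _)⟩⟩

end
end SingCat

theorem theorem4p10 (R : Type u) [Ring R] [SingCat.IsLeftCoherentRing R] :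
    (SingCat.Phi R).Full ∧ (SingCat.Phi R).Faithful ∧
      SingCat.IsTriangleFunctor R (SingCat.Phi R) ∧
      ((SingCat.Phi R).EssSurj ↔ SingCat.DenseUpToSummands R (SingCat.Phi R)) ∧
      (SingCat.DenseUpToSummands R (SingCat.Phi R) ↔ SingCat.IsLeftGRegular R) :=
  ⟨inferInstance, inferInstance, SingCat.isTriangleFunctor_phi,
    ⟨fun _ => SingCat.denseUpToSummands_of_essSurj, fun h => h.isLeftGRegular.essSurj_phi⟩,
    ⟨fun h => h.isLeftGRegular, fun h =>
      have := h.essSurj_phi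
      SingCat.denseUpToSummands_of_essSurj⟩⟩
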